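/- Let $E_0,E_1$ be complex Banach spaces with $E_1\subset E_0$ densely and continuously embedded, let $T>0$, $J=[0,T]$, $\dot J=(0,T]$, and let $A\in\mathcal B(E_1,E_0)$ be closed as an unbounded operator on $E_0$ with domain $E_1$. For a Banach space $E$ and $\sigma\in(0,1)$ let $BUC_{1-\sigma}(J,E)$ be the space of all $u\in C(\dot J,E)$ such that $t\mapsto t^{1-\sigma}u(t)$ is bounded and uniformly continuous on $\dot J$ and $\lim_{t\to0^+}t^{1-\sigma}\|u(t)\|=0$, with norm $\sup_{t\in\dot J}t^{1-\sigma}\|u(t)\|$, and let $BUC^1_{1-\sigma}(J,E)$ be the space of all $u\in C^1(\dot J,E)$ with $u,\dot u\in BUC_{1-\sigma}(J,E)$. For $\sigma=1$ let $BUC_{0}(J,E)=C(J,E)$ and $BUC^1_{0}(J,E)=C^1(J,E)$. For $\sigma\in(0,1]$ set $$\mathbb E_0(J)=BUC_{1-\sigma}(J,E_0),\qquad \mathbb E_1(J)=BUC^1_{1-\sigma}(J,E_0)\cap BUC_{1-\sigma}(J,E_1),$$ the latter with norm $\sup_{t\in\dot J}t^{1-\sigma}\big(\|\dot u(t)\|_{E_0}+\|u(t)\|_{E_1}\big)$.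 Let $\gamma u=u(0)=\lim_{t\to0^+}u(t)$ (limit in $E_0$) for $u\in\mathbb E_1(J)$, and equip $\gamma\mathbb E_1=\{\gamma u:u\in\mathbb E_1(J)\}$ with the norm $\|x\|_\gamma=\inf\{\|u\|_{\mathbb E_1(J)}:u\in\mathbb E_1(J),\ \gamma u=x\}$. The pair $(\mathbb E_0(J),\mathbb E_1(J))$ is called a pair of maximal regularity for $A$ if for every $(f,x)\in\mathbb E_0(J)\times\gamma\mathbb E_1$ there is a unique $u\in\mathbb E_1(J)$ with $\dot u(t)-Au(t)=f(t)$ for $t\in\dot J$ and $\gamma u=x$, and the map $(f,x)\mapsto u$ is continuous. If, for some $\sigma\in(0,1]$, $(\mathbb E_0(J),\mathbb E_1(J))$ is a pair of maximal regularity for $A$, then $A$, with domain $E_1$, generates a strongly continuous analytic semigroup on $E_0$. -/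

import Mathlib

open Set Filter Topology

noncomputable section

namespace PrescribedSingularity

/-! ### Densely embedded pairs and closed operators

The inclusion of `E₁` in `E₀` is recorded by the natural injection `i : E₁ → E₀`. -/

section Operators

variable {E₀ E₁ : Type*} [NormedAddCommGroup E₀] [NormedSpace ℂ E₀]
  [NormedAddCommGroup E₁] [NormedSpace ℂ E₁]

/-- `(E₀, E₁)` is a pair of densely embedded spaces, with natural injection `i`. -/
structure DenselyEmbedded (i : E₁ →L[ℂ] E₀) : Prop where
  injective : Function.Injective i
  denseRange : DenseRange i

/-- `A`, seen as an unbounded operator on `E₀` with domain `E₁`, is closed: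
its graph is closed in `E₀ × E₀`. -/
def ClosedOn (i A : E₁ →L[ℂ] E₀) : Prop :=
  IsClosed {p : E₀ × E₀ | ∃ a : E₁, i a = p.1 ∧ A a = p.2}

end Operators

/-! ### Time-weighted spaces of continuous functions

Functions on `(0,T]` are represented by functions on `ℝ` of which only the values on `(0,T]` are
used; two of them are the same element when they agree on `(0,T]`. -/

section Spaces

variable {E : Type*} [NormedAddCommGroup E] [NormedSpace ℝ E]

/-- The space `BUC_{1-σ}(J,E)`, `J = [0,T]`. For `σ < 1`, the function `t ↦ t^{1-σ} u(t)` is bounded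
and uniformly continuous on `(0,T]` and tends to `0` at `0`. For `σ = 1` there is no weight and no
condition at `0`: the space is `BUC((0,T],E)`, which is `C([0,T],E)` when `E` is complete, by unique
continuous extension to `0`. -/
structure MemBUC (σ T : ℝ) (u : ℝ → E) : Prop where
  continuousOn : ContinuousOn u (Ioc 0 T)
  bounded : ∃ C : ℝ, ∀ t ∈ Ioc (0 : ℝ) T, ‖t ^ (1 - σ) • u t‖ ≤ C
  uniformContinuousOn : UniformContinuousOn (fun t : ℝ => t ^ (1 - σ) • u t) (Ioc 0 T)
  tendsto_zero : σ < 1 → Tendsto (fun t : ℝ => t ^ (1 - σ) * ‖u t‖) (𝓝[>] 0) (𝓝 0)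

/-- The norm `sup_{0 < t ≤ T} t^{1-σ} ‖u(t)‖` of `BUC_{1-σ}(J,E)`. -/
def normBUC (σ T : ℝ) (u : ℝ → E) : ℝ :=
  ⨆ t : Ioc (0 : ℝ) T, (t : ℝ) ^ (1 - σ) * ‖u t‖

/-- The derivative on `(0,T]`, one-sided at the end point `T`. -/
def timeDeriv (T : ℝ) (u : ℝ → E) (t : ℝ) : E :=
  derivWithin u (Ioc 0 T) t

/-- The space `BUC¹_{1-σ}(J,E)`: functions in `C¹((0,T],E)` that belong to `BUC_{1-σ}(J,E)` together
with their derivative. -/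
structure MemBUC1 (σ T : ℝ) (u : ℝ → E) : Prop where
  differentiableOn : DifferentiableOn ℝ u (Ioc 0 T)
  mem : MemBUC σ T u
  deriv_mem : MemBUC σ T (timeDeriv T u)

end Spaces

/-! ### Maximal regularity -/

section MaximalRegularity

variable {E₀ E₁ : Type*} [NormedAddCommGroup E₀] [NormedSpace ℂ E₀]
  [NormedAddCommGroup E₁] [NormedSpace ℂ E₁]

/-- The space `𝔼₁(J) = BUC¹_{1-σ}(J,E₀) ∩ BUC_{1-σ}(J,E₁)`. -/
structure MemE1 (i : E₁ →L[ℂ] E₀) (σ T : ℝ) (u : ℝ → E₁) : Prop where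
  mem_buc1 : MemBUC1 σ T (fun t => i (u t))
  mem_buc : MemBUC σ T u

/-- The norm `sup_{0 < t ≤ T} t^{1-σ} (‖u'(t)‖_{E₀} + ‖u(t)‖_{E₁})` of `𝔼₁(J)`. -/
def normE1 (i : E₁ →L[ℂ] E₀) (σ T : ℝ) (u : ℝ → E₁) : ℝ :=
  ⨆ t : Ioc (0 : ℝ) T, (t : ℝ) ^ (1 - σ) * (‖timeDeriv T (fun s => i (u s)) t‖ + ‖u t‖)

/-- `γ u = x`, that is `u(0) = x`, where `u(0)` is the limit of `u(t)` in `E₀` as `t → 0+`. -/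
def HasTrace (i : E₁ →L[ℂ] E₀) (u : ℝ → E₁) (x : E₀) : Prop :=
  Tendsto (fun t => i (u t)) (𝓝[>] 0) (𝓝 x)

/-- The trace space `γ𝔼₁`. -/
def traceSpace (i : E₁ →L[ℂ] E₀) (σ T : ℝ) : Set E₀ :=
  {x | ∃ u : ℝ → E₁, MemE1 i σ T u ∧ HasTrace i u x}

/-- The norm of the trace space: the infimum of `‖u‖_{𝔼₁(J)}` over `u ∈ 𝔼₁(J)` with `γ u = x`. -/
def normTrace (i : E₁ →L[ℂ] E₀) (σ T : ℝ) (x : E₀) : ℝ :=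
  sInf {r : ℝ | ∃ u : ℝ → E₁, MemE1 i σ T u ∧ HasTrace i u x ∧ normE1 i σ T u = r}

/-- `u ∈ 𝔼₁(J)` solves `u' - A u = f` on `(0,T]`, `u(0) = x`. -/
structure IsSolution (i A : E₁ →L[ℂ] E₀) (σ T : ℝ) (f : ℝ → E₀) (x : E₀) (u : ℝ → E₁) :
    Prop where
  mem : MemE1 i σ T u
  eqn : ∀ t ∈ Ioc (0 : ℝ) T, timeDeriv T (fun s => i (u s)) t - A (u t) = f t
  trace : HasTrace i u x

/-- `(BUC_{1-σ}(J,E₀), BUC¹_{1-σ}(J,E₀) ∩ BUC_{1-σ}(J,E₁))` is a pair of maximal regularity for `A`: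
for all `(f, x) ∈ 𝔼₀(J) × γ𝔼₁` there is exactly one solution `u ∈ 𝔼₁(J)`, and the (linear) solution
map `(f, x) ↦ u` is continuous, i.e. bounded. -/
structure MaximalRegularity (i A : E₁ →L[ℂ] E₀) (σ T : ℝ) : Prop where
  exists_solution : ∀ f : ℝ → E₀, MemBUC σ T f → ∀ x ∈ traceSpace i σ T,
    ∃ u, IsSolution i A σ T f x u
  unique_solution : ∀ f : ℝ → E₀, MemBUC σ T f → ∀ x ∈ traceSpace i σ T,
    ∀ u w, IsSolution i A σ T f x u → IsSolution i A σ T f x w → EqOn u w (Ioc 0 T)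
  bounded_solution : ∃ M : ℝ, ∀ f : ℝ → E₀, MemBUC σ T f → ∀ x ∈ traceSpace i σ T,
    ∀ u, IsSolution i A σ T f x u → normE1 i σ T u ≤ M * (normBUC σ T f + normTrace i σ T x)

end MaximalRegularity

/-! ### Strongly continuous analytic semigroups -/

section Semigroups

variable {E : Type*} [NormedAddCommGroup E] [NormedSpace ℂ E]

/-- The open sector `{z ≠ 0 : |arg z| < θ}`. -/
def sector (θ : ℝ) : Set ℂ := {z | z ≠ 0 ∧ |z.arg| < θ}

/-- `S` is a strongly continuous analytic semigroup on the sector of half-angle `θ` (together with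
the vertex `0`). -/
structure IsAnalyticSemigroup (θ : ℝ) (S : ℂ → E →L[ℂ] E) : Prop where
  map_zero : S 0 = 1
  map_add : ∀ z ∈ sector θ, ∀ w ∈ sector θ, S (z + w) = S z * S w
  holomorphic : DifferentiableOn ℂ S (sector θ)
  strong_continuity : ∀ x : E, Tendsto (fun z => S z x) (𝓝[sector θ] 0) (𝓝 x)

variable {E₁ : Type*} [NormedAddCommGroup E₁] [NormedSpace ℂ E₁]

/-- `A : E₁ ⊆ E → E` generates a strongly continuous analytic semigroup on `E`: for some such
semigroup `S` the generator, i.e. the strong derivative from the right of `t ↦ S(t)` at `t = 0` with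
its maximal domain, is `A` with domain `E₁`. -/
def GeneratesAnalyticSemigroup (i A : E₁ →L[ℂ] E) : Prop :=
  ∃ θ ∈ Ioo (0 : ℝ) (Real.pi / 2), ∃ S : ℂ → E →L[ℂ] E, IsAnalyticSemigroup θ S ∧
    ∀ x y : E, Tendsto (fun t : ℝ => t⁻¹ • (S (t : ℂ) x - x)) (𝓝[>] 0) (𝓝 y) ↔
      ∃ a : E₁, i a = x ∧ A a = y

end Semigroups

end PrescribedSingularity

end

/-! Maximal regularity is tested on explicit exponentials, which turns it into resolvent estimates
for `A`. For the a priori bound, insert u(t) = t e^{lt} a. It has trace zero, and comparing u with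
its right-hand side at t = T gives |l| ‖a‖₀ + ‖a‖₁ ≤ K ‖(l - A)a‖ for Re l ≥ 0 and |l| large
(`exists_norm_le`). Evaluating at T makes the weight t^{1-σ} cancel, so the argument is the same for
all σ. For surjectivity of l - A, solve u' - Au = e^{i Im(l) t} y with u(0) = 0 and take the
truncated Laplace transform Re(l) ∫₀ᵀ e^{-lt} u(t) dt. It solves (l - A)a = y up to an error that is
exponentially small in Re l (`exists_norm_sub_le`). Together with the a priori bound, which makes
the range closed, Riesz's lemma gives surjectivity (`surjective_of_norm_le_of_norm_sub_le`). After a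
shift by ω, perturbation off the imaginary axis extends the estimate to a sector of half-angle
larger than π/2 (`exists_sector_estimate`). Density of E₁ and the classical generation theorem
finish the proof. The generation theorem is proved here for B = A - ω through S(z) = π⁻¹ ∫ e^m (m -
zB)^{-3} ds over m = 1 + is. This is the Dunford integral after substituting m for lz and
integrating by parts twice, so that it converges absolutely on a line that does not depend on z. -/

noncomputable section

namespace PrescribedSingularity

/-! ### Sectors -/

/-- The open sector `Re l + ε |Im l| > 0`, which contains the closed right half-plane without `0`. -/
def resolventSector (ε : ℝ) : Set ℂ := {l | 0 < l.re + ε * |l.im|}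

theorem isOpen_resolventSector (ε : ℝ) : IsOpen (resolventSector ε) :=
  isOpen_lt continuous_const
    (Complex.continuous_re.add (continuous_const.mul Complex.continuous_im.abs))

theorem ne_zero_of_mem_resolventSector {ε : ℝ} {l : ℂ} (hl : l ∈ resolventSector ε) : l ≠ 0 := by
  rintro rfl
  simp [resolventSector] at hl

theorem mem_sector_arctan {ε : ℝ} (hε : 0 < ε) {z : ℂ} :
    z ∈ sector (Real.arctan ε) ↔ |z.im| < ε * z.re := by
  have key : 0 < z.re → (|z.arg| < Real.arctan ε ↔ |z.im| < ε * z.re) := by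
    intro hre
    have h1 : |z.arg| < Real.pi / 2 := Complex.abs_arg_lt_pi_div_two_iff.2 (Or.inl hre)
    have h2 := abs_lt.1 h1
    have h3 : z.arg = Real.arctan (z.im / z.re) := by
      rw [← Complex.tan_arg, Real.arctan_tan h2.1 h2.2]
    rw [h3, abs_lt, ← Real.arctan_neg, Real.arctan_strictMono.lt_iff_lt, Real.arctan_strictMono.lt_iff_lt, ← abs_lt,
      abs_div, abs_of_pos hre, div_lt_iff₀ hre]
  constructor
  · rintro ⟨h0, h⟩
    have h1 : |z.arg| < Real.pi / 2 := h.trans (Real.arctan_lt_pi_div_two ε)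
    rcases Complex.abs_arg_lt_pi_div_two_iff.1 h1 with hre | hz
    · exact (key hre).1 h
    · exact absurd hz h0
  · intro h
    have hre : 0 < z.re := by
      by_contra hneg
      nlinarith [abs_nonneg z.im]
    refine ⟨?_, (key hre).2 h⟩
    rintro rfl
    simp at hre

theorem re_pos_of_mem_sector {ε : ℝ} (hε : 0 < ε) {z : ℂ} (hz : z ∈ sector (Real.arctan ε)) :
    0 < z.re := by
  rw [mem_sector_arctan hε] at hz
  by_contra hneg
  nlinarith [abs_nonneg z.im]

theorem isOpen_sector_arctan {ε : ℝ} (hε : 0 < ε) : IsOpen (sector (Real.arctan ε)) := by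
  have : sector (Real.arctan ε) = {z : ℂ | |z.im| < ε * z.re} := by
    ext z
    exact mem_sector_arctan hε
  rw [this]
  exact isOpen_lt Complex.continuous_im.abs (continuous_const.mul Complex.continuous_re)

theorem add_mem_sector_arctan {ε : ℝ} (hε : 0 < ε) {z w : ℂ} (hz : z ∈ sector (Real.arctan ε))
    (hw : w ∈ sector (Real.arctan ε)) : z + w ∈ sector (Real.arctan ε) := by
  rw [mem_sector_arctan hε] at *
  rw [Complex.add_im, Complex.add_re]
  linarith [abs_add_le z.im w.im]

theorem ofReal_mul_mem_sector_arctan {ε : ℝ} (hε : 0 < ε) {z : ℂ} {r : ℝ} (hr : 0 < r)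
    (hz : z ∈ sector (Real.arctan ε)) : (r : ℂ) * z ∈ sector (Real.arctan ε) := by
  rw [mem_sector_arctan hε] at *
  rw [Complex.re_ofReal_mul, Complex.im_ofReal_mul, abs_mul, abs_of_pos hr]
  nlinarith

theorem ofReal_mem_sector_arctan {ε : ℝ} (hε : 0 < ε) {r : ℝ} (hr : 0 < r) :
    (r : ℂ) ∈ sector (Real.arctan ε) := by
  rw [mem_sector_arctan hε]
  simp [hε, hr]

/-- The line of integration `Re m = 1`. -/
def line (s : ℝ) : ℂ := 1 + s * Complex.I

theorem line_re (s : ℝ) : (line s).re = 1 := by simp [line]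

theorem line_im (s : ℝ) : (line s).im = s := by simp [line]

theorem normSq_line (s : ℝ) : ‖line s‖ ^ 2 = 1 + s ^ 2 := by
  rw [← Complex.normSq_eq_norm_sq, Complex.normSq_apply, line_re, line_im]
  ring

theorem one_le_norm_line (s : ℝ) : 1 ≤ ‖line s‖ := by
  have := normSq_line s
  nlinarith [norm_nonneg (line s), sq_nonneg s]

theorem line_ne_zero (s : ℝ) : line s ≠ 0 := by
  rw [← norm_pos_iff]
  linarith [one_le_norm_line s]

theorem norm_exp_line (s : ℝ) : ‖Complex.exp (line s)‖ = Real.exp 1 := by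
  rw [Complex.norm_exp, line_re]

theorem hasDerivAt_line (s : ℝ) : HasDerivAt line Complex.I s := by
  have := ((hasDerivAt_id s).ofReal_comp.mul_const Complex.I).const_add 1
  rw [Complex.ofReal_one, one_mul] at this
  exact this

theorem continuous_line : Continuous line := by
  unfold line
  fun_prop

/-- Dividing by z turns the argument by less than arctan ε, and `resolventSector ε` has half-angle
π/2 + arctan ε. This is why one line serves for every z in the sector. -/
theorem line_div_mem {ε : ℝ} (hε : 0 < ε) (hε1 : ε ≤ 1) {z : ℂ}
    (hz : z ∈ sector (Real.arctan ε)) (s : ℝ) : line s / z ∈ resolventSector ε := by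
  have hre := re_pos_of_mem_sector hε hz
  rw [mem_sector_arctan hε] at hz
  have hn : 0 < Complex.normSq z := Complex.normSq_pos.2 (by rintro rfl; simp at hre)
  have h1 : (line s / z).re = (z.re + s * z.im) / Complex.normSq z := by
    rw [Complex.div_re, line_re, line_im]; ring
  have h2 : (line s / z).im = (s * z.re - z.im) / Complex.normSq z := by
    rw [Complex.div_im, line_re, line_im]; ring
  change 0 < (line s / z).re + ε * |(line s / z).im|
  rw [h1, h2, abs_div, abs_of_pos hn]
  have h3 : |s| * z.re - |z.im| ≤ |s * z.re - z.im| := by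
    have := abs_sub_abs_le_abs_sub (s * z.re) z.im
    rwa [abs_mul, abs_of_pos hre] at this
  have h4 : -(|s| * |z.im|) ≤ s * z.im := by
    rw [← abs_mul]; exact neg_abs_le _
  -- With z = x + iy the left side is at least (x - ε|y|) + |s|(εx - |y|). The first bracket is
  -- positive because |y| < εx and ε ≤ 1.
  have h5 : 0 < z.re + s * z.im + ε * |s * z.re - z.im| := by
    nlinarith [abs_nonneg s, abs_nonneg z.im, mul_le_mul_of_nonneg_left h3 hε.le,
      mul_nonneg (abs_nonneg s) (sub_nonneg.2 hz.le)]
  have : (z.re + s * z.im) / Complex.normSq z + ε * (|s * z.re - z.im| / Complex.normSq z)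
      = (z.re + s * z.im + ε * |s * z.re - z.im|) / Complex.normSq z := by ring
  rw [this]
  positivity

/-! ### A contour integral -/

theorem integral_Ioi_sq_mul_exp_neg {m : ℂ} (hm : m.re = 1) :
    ∫ t in Ioi (0 : ℝ), (t : ℂ) ^ 2 * Complex.exp (-(m * t)) = 2 * m⁻¹ ^ 3 := by
  have hm0 : m ≠ 0 := by
    rintro rfl
    simp at hm
  have hnorm : ∀ t : ℝ, ‖Complex.exp (-(m * t))‖ = Real.exp (-t) := by
    intro t
    rw [Complex.norm_exp]
    simp [hm]
  have hd : ∀ t : ℝ, HasDerivAt (fun t : ℝ => -(Complex.exp (-(m * t)) *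
      (t ^ 2 * m⁻¹ + t * (2 * m⁻¹ ^ 2) + 2 * m⁻¹ ^ 3)))
      ((t : ℂ) ^ 2 * Complex.exp (-(m * t))) t := by
    intro t
    have h0 : HasDerivAt (fun t : ℝ => (t : ℂ)) 1 t := (hasDerivAt_id t).ofReal_comp
    have h1 := (h0.const_mul m).neg.cexp
    have h2 := (((h0.pow 2).mul_const m⁻¹).add (h0.mul_const (2 * m⁻¹ ^ 2))).add_const (2 * m⁻¹ ^ 3)
    refine ((h1.mul h2).neg).congr_deriv ?_
    simp only [Pi.add_apply, Pi.pow_apply, Pi.neg_apply]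
    field_simp
    ring
  have hint : MeasureTheory.IntegrableOn (fun t : ℝ => (t : ℂ) ^ 2 * Complex.exp (-(m * t)))
      (Ioi 0) := by
    refine MeasureTheory.Integrable.mono'
      (Real.GammaIntegral_convergent (s := 3) (by norm_num)) (by fun_prop) ?_
    refine MeasureTheory.ae_restrict_of_forall_mem measurableSet_Ioi fun t ht => ?_
    rw [norm_mul, hnorm, norm_pow, Complex.norm_real, Real.norm_of_nonneg (le_of_lt ht),
      mul_comm]
    norm_num
  have hlim : ∀ k : ℕ, Tendsto (fun t : ℝ => Complex.exp (-(m * t)) * (t : ℂ) ^ k) atTop (𝓝 0) := by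
    intro k
    rw [tendsto_zero_iff_norm_tendsto_zero]
    refine (Real.tendsto_pow_mul_exp_neg_atTop_nhds_zero k).congr' ?_
    filter_upwards [eventually_ge_atTop 0] with t ht
    rw [norm_mul, hnorm, norm_pow, Complex.norm_real, Real.norm_of_nonneg ht, mul_comm]
  have hlim' : Tendsto (fun t : ℝ => -(Complex.exp (-(m * t)) *
      (t ^ 2 * m⁻¹ + t * (2 * m⁻¹ ^ 2) + 2 * m⁻¹ ^ 3))) atTop (𝓝 0) := by
    have := ((((hlim 2).mul_const m⁻¹).add ((hlim 1).mul_const (2 * m⁻¹ ^ 2))).add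
      ((hlim 0).mul_const (2 * m⁻¹ ^ 3))).neg
    simp only [zero_mul, add_zero, neg_zero] at this
    refine this.congr fun t => ?_
    ring
  rw [MeasureTheory.integral_Ioi_of_hasDerivAt_of_tendsto' (fun t _ => hd t) hint hlim']
  simp

-- This normalizes the semigroup: it is the case B = 0 of the contour integral. The function t²
-- e^{-t} on t > 0 is continuous and integrable with Fourier transform 2 (1 + 2πiv)^{-3}, also
-- integrable, so Fourier inversion holds pointwise; it is read off at t = 1.
open FourierTransform in
theorem integral_exp_line_div_cube :
    ∫ s : ℝ, Complex.exp (line s) * ((line s)⁻¹) ^ 3 = Real.pi := by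
  set f : ℝ → ℂ := fun t => if 0 < t then (t : ℂ) ^ 2 * Complex.exp (-t) else 0 with hf
  have hfc : Continuous f := by
    have : f = fun t : ℝ => ((max t 0 : ℝ) : ℂ) ^ 2 * Complex.exp (-t) := by
      ext t
      rcases lt_or_ge 0 t with h | h
      · simp [hf, h, h.le]
      · simp [hf, h, not_lt.2 h]
    rw [this]
    fun_prop
  have hfind : f = indicator (Ioi 0) (fun t : ℝ => (t : ℂ) ^ 2 * Complex.exp (-t)) := by
    ext t
    simp [hf, indicator]
  have hfi : MeasureTheory.Integrable f := by
    rw [hfind, MeasureTheory.integrable_indicator_iff measurableSet_Ioi]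
    have := (Real.GammaIntegral_convergent (s := 3) (by norm_num)).ofReal (𝕜 := ℂ)
    refine MeasureTheory.IntegrableOn.congr_fun this (fun t ht => ?_) measurableSet_Ioi
    have : t ^ ((3 : ℝ) - 1) = t ^ 2 := by norm_num
    simp only [this]
    push_cast
    rw [mul_comm, ← Complex.ofReal_neg]
    exact congrArg _ (Complex.ofReal_exp (-t))
  have hF : ∀ v : ℝ, 𝓕 f v = 2 * ((line (2 * Real.pi * v))⁻¹) ^ 3 := by
    intro v
    rw [Real.fourier_real_eq_integral_exp_smul]
    rw [← integral_Ioi_sq_mul_exp_neg (line_re _),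
      ← MeasureTheory.integral_indicator measurableSet_Ioi]
    congr 1
    ext t
    rw [hfind]
    by_cases ht : t ∈ Ioi (0 : ℝ)
    · rw [indicator_of_mem ht, indicator_of_mem ht, smul_eq_mul,
        mul_left_comm, ← Complex.exp_add]
      congr 2
      simp only [line]
      push_cast
      ring
    · rw [indicator_of_notMem ht, indicator_of_notMem ht, smul_zero]
  have hint : MeasureTheory.Integrable (fun s : ℝ => ((line s)⁻¹) ^ 3) := by
    refine integrable_inv_one_add_sq.mono' ?_ (Eventually.of_forall fun s => ?_)
    · exact ((continuous_line.inv₀ line_ne_zero).pow 3).aestronglyMeasurable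
    · rw [← normSq_line, norm_pow, norm_inv, ← inv_pow]
      exact pow_le_pow_of_le_one (by positivity) (inv_le_one_of_one_le₀ (one_le_norm_line s))
        (by norm_num)
  have hFi : MeasureTheory.Integrable (𝓕 f) := by
    have : 𝓕 f = fun v => 2 * ((line (2 * Real.pi * v))⁻¹) ^ 3 := funext hF
    rw [this]
    exact (hint.comp_mul_left' (by positivity : 2 * Real.pi ≠ 0)).const_mul 2
  have hinv := congrFun (hfc.fourierInv_fourier_eq hfi hFi) 1
  rw [Real.fourierInv_eq_fourier_neg, Real.fourier_real_eq_integral_exp_smul] at hinv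
  have h3 : ∀ v : ℝ, Complex.exp (((-2 * Real.pi * v * (-1) : ℝ) : ℂ) * Complex.I) • 𝓕 f v
      = (fun s : ℝ => 2 * Complex.exp (-1) * (Complex.exp (line s) * ((line s)⁻¹) ^ 3))
        (2 * Real.pi * v) := by
    intro v
    have : Complex.exp (line (2 * Real.pi * v))
        = Complex.exp 1 * Complex.exp (((-2 * Real.pi * v * (-1) : ℝ) : ℂ) * Complex.I) := by
      rw [← Complex.exp_add]
      congr 1
      simp only [line]
      push_cast
      ring
    simp only [hF, this, smul_eq_mul]
    have h0 : Complex.exp (-1) * Complex.exp 1 = 1 := by rw [← Complex.exp_add]; simp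
    linear_combination (-2 * ((line (2 * Real.pi * v))⁻¹) ^ 3 *
      Complex.exp (((-2 * Real.pi * v * (-1) : ℝ) : ℂ) * Complex.I)) * h0
  rw [MeasureTheory.integral_congr_ae (Eventually.of_forall h3),
    MeasureTheory.Measure.integral_comp_mul_left (fun s : ℝ => 2 * Complex.exp (-1) *
      (Complex.exp (line s) * ((line s)⁻¹) ^ 3)), MeasureTheory.integral_const_mul] at hinv
  have hf1 : f 1 = Complex.exp (-1) := by simp [hf]
  rw [hf1, abs_of_pos (by positivity)] at hinv
  have he : Complex.exp (-1) ≠ 0 := Complex.exp_ne_zero _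
  have hpi : (Real.pi : ℂ) ≠ 0 := by exact_mod_cast Real.pi_ne_zero
  rw [Complex.real_smul] at hinv
  push_cast at hinv
  field_simp at hinv
  simpa only [div_eq_mul_inv, inv_pow] using hinv

/-! ### Semigroups from resolvents on a sector -/

section Resolvents

open MeasureTheory

variable {E : Type*} [NormedAddCommGroup E] [NormedSpace ℂ E]

/-- `R` satisfies the resolvent identity and decays like `C / |l|` on `resolventSector ε`. -/
structure IsSectorialResolvent (ε C : ℝ) (R : ℂ → E →L[ℂ] E) : Prop where
  eps_pos : 0 < ε
  eps_le : ε ≤ 1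
  identity : ∀ l ∈ resolventSector ε, ∀ m ∈ resolventSector ε,
    R l - R m = (m - l) • (R l * R m)
  bound : ∀ l ∈ resolventSector ε, ‖l‖ * ‖R l‖ ≤ C

variable {ε C : ℝ} {R : ℂ → E →L[ℂ] E}

namespace IsSectorialResolvent

theorem const_nonneg (hR : IsSectorialResolvent ε C R) : 0 ≤ C :=
  le_trans (by positivity) (hR.bound 1 (by simp [resolventSector]))

theorem commute (hR : IsSectorialResolvent ε C R) {l m : ℂ} (hl : l ∈ resolventSector ε)
    (hm : m ∈ resolventSector ε) : R l * R m = R m * R l := by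
  by_cases h : l = m
  · rw [h]
  have h1 := hR.identity l hl m hm
  have h2 := hR.identity m hm l hl
  have h3 : (m - l) • (R l * R m - R m * R l) = 0 := by
    rw [smul_sub, ← h1, show (m - l) = -(l - m) by ring, neg_smul, ← h2]
    abel
  exact sub_eq_zero.1 ((smul_eq_zero.1 h3).resolve_left (sub_ne_zero.2 (Ne.symm h)))

theorem norm_le (hR : IsSectorialResolvent ε C R) {l : ℂ} (hl : l ∈ resolventSector ε) :
    ‖R l‖ ≤ C / ‖l‖ := by
  rw [le_div_iff₀ (norm_pos_iff.2 (ne_zero_of_mem_resolventSector hl)), mul_comm]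
  exact hR.bound l hl

theorem continuousAt (hR : IsSectorialResolvent ε C R) {l : ℂ} (hl : l ∈ resolventSector ε) :
    ContinuousAt R l := by
  have hl0 := ne_zero_of_mem_resolventSector hl
  rw [ContinuousAt, tendsto_iff_norm_sub_tendsto_zero]
  have hlim : Tendsto (fun m : ℂ => ‖l - m‖ * (C / ‖m‖ * ‖R l‖)) (𝓝 l) (𝓝 0) := by
    have : ContinuousAt (fun m : ℂ => ‖l - m‖ * (C / ‖m‖ * ‖R l‖)) l := by
      have : ‖l‖ ≠ 0 := norm_ne_zero_iff.2 hl0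
      fun_prop (disch := assumption)
    simpa [ContinuousAt] using this
  refine squeeze_zero' (Eventually.of_forall fun _ => norm_nonneg _) ?_ hlim
  filter_upwards [(isOpen_resolventSector ε).mem_nhds hl] with m hm
  rw [hR.identity m hm l hl, norm_smul]
  gcongr
  exact (norm_mul_le _ _).trans (by gcongr; exact hR.norm_le hm)

theorem hasDerivAt (hR : IsSectorialResolvent ε C R) {l : ℂ} (hl : l ∈ resolventSector ε) :
    HasDerivAt R (-(R l * R l)) l := by
  rw [hasDerivAt_iff_tendsto_slope]
  have h1 : Tendsto (fun m => -(R m * R l)) (𝓝[≠] l) (𝓝 (-(R l * R l))) :=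
    (((hR.continuousAt hl).mul continuousAt_const).neg).tendsto.mono_left nhdsWithin_le_nhds
  refine h1.congr' ?_
  filter_upwards [nhdsWithin_le_nhds ((isOpen_resolventSector ε).mem_nhds hl),
    self_mem_nhdsWithin] with m hm hne
  have : m - l ≠ 0 := sub_ne_zero.2 hne
  rw [slope_def_module, hR.identity m hm l hl, smul_smul, show (m - l)⁻¹ * (l - m) = -1 by
    field_simp; ring, neg_one_smul]

end IsSectorialResolvent

/-- The operator `(m - z B)⁻¹`, for `R` the resolvent of `B`. -/
def scaledResolvent (R : ℂ → E →L[ℂ] E) (z m : ℂ) : E →L[ℂ] E := z⁻¹ • R (m / z)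

namespace IsSectorialResolvent

variable {z w : ℂ}

theorem norm_scaledResolvent_le (hR : IsSectorialResolvent ε C R)
    (hz : z ∈ sector (Real.arctan ε)) (s : ℝ) :
    ‖scaledResolvent R z (line s)‖ ≤ C * ‖line s‖⁻¹ := by
  have h := hR.norm_le (line_div_mem hR.eps_pos hR.eps_le hz s)
  have hz0 : 0 < ‖z‖ := norm_pos_iff.2 hz.1
  have hs0 : 0 < ‖line s‖ := norm_pos_iff.2 (line_ne_zero s)
  rw [scaledResolvent, norm_smul, norm_inv]
  calc ‖z‖⁻¹ * ‖R (line s / z)‖ ≤ ‖z‖⁻¹ * (C / ‖line s / z‖) := by gcongr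
    _ = C * ‖line s‖⁻¹ := by rw [norm_div]; field_simp

/-- With Q = (m - zB)⁻¹ the derivative is BQ², written without B by means of zBQ = mQ - 1. -/
theorem hasDerivAt_scaledResolvent_left (hR : IsSectorialResolvent ε C R) (hz : z ≠ 0) {m : ℂ}
    (hm : m / z ∈ resolventSector ε) :
    HasDerivAt (fun z => scaledResolvent R z m)
      (z⁻¹ • (m • scaledResolvent R z m ^ 2 - scaledResolvent R z m)) z := by
  have h1 : HasDerivAt (fun z : ℂ => m / z) (-m / z ^ 2) z := by
    refine ((hasDerivAt_inv hz).const_mul m).congr_deriv ?_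
    field_simp
  have h2 := (hasDerivAt_inv hz).smul ((hR.hasDerivAt hm).scomp z h1)
  refine h2.congr_deriv ?_
  simp only [scaledResolvent, smul_sub, smul_neg, pow_two, Function.comp, smul_mul_assoc,
    mul_smul_comm]
  match_scalars <;> field_simp

theorem hasDerivAt_scaledResolvent_right (hR : IsSectorialResolvent ε C R) {m : ℂ}
    (hm : m / z ∈ resolventSector ε) :
    HasDerivAt (fun m => scaledResolvent R z m) (-scaledResolvent R z m ^ 2) m := by
  have h1 : HasDerivAt (fun m : ℂ => m / z) z⁻¹ m := by
    simpa [div_eq_mul_inv] using (hasDerivAt_id m).mul_const z⁻¹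
  refine (((hR.hasDerivAt hm).scomp m h1).const_smul z⁻¹).congr_deriv ?_
  simp only [scaledResolvent, smul_mul_assoc, mul_smul_comm, smul_neg, pow_two]

theorem continuous_scaledResolvent (hR : IsSectorialResolvent ε C R)
    (hz : z ∈ sector (Real.arctan ε)) : Continuous fun s => scaledResolvent R z (line s) := by
  refine continuous_iff_continuousAt.2 fun s => ?_
  exact ContinuousAt.comp (f := line) (g := fun m => scaledResolvent R z m)
    (hR.hasDerivAt_scaledResolvent_right
      (line_div_mem hR.eps_pos hR.eps_le hz s)).continuousAt continuous_line.continuousAt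

theorem scaledResolvent_commute (hR : IsSectorialResolvent ε C R)
    (hz : z ∈ sector (Real.arctan ε)) (s : ℝ) {l : ℂ} (hl : l ∈ resolventSector ε) :
    Commute (scaledResolvent R z (line s)) (R l) :=
  Commute.smul_left (hR.commute (line_div_mem hR.eps_pos hR.eps_le hz s) hl) _

/-- Both sides are B (m - zB)⁻¹ R(l): on the left B is expressed through the scaled resolvent, on
the right through B R(l) = l R(l) - 1. -/
theorem scaledResolvent_mul (hR : IsSectorialResolvent ε C R)
    (hz : z ∈ sector (Real.arctan ε)) (s : ℝ) {l : ℂ} (hl : l ∈ resolventSector ε) :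
    z⁻¹ • ((line s • scaledResolvent R z (line s) - 1) * R l)
      = scaledResolvent R z (line s) * (l • R l - 1) := by
  have hz0 := hz.1
  have hid := hR.identity _ (line_div_mem hR.eps_pos hR.eps_le hz s) l hl
  have h2 : (line s / z) • (R (line s / z) * R l) = R l - R (line s / z)
      + l • (R (line s / z) * R l) := by
    rw [sub_smul] at hid
    rw [← neg_sub (R (line s / z)), hid]
    abel
  have h3 : line s * z⁻¹ = line s / z := rfl
  rw [scaledResolvent, smul_smul, h3, sub_mul, one_mul, smul_mul_assoc, h2, smul_mul_assoc,
    mul_sub, mul_one, mul_smul_comm]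
  congr 1
  abel

end IsSectorialResolvent

/-- The integrands `exp(m) m^j (m - z B)^{-n}` on the line `Re m = 1`. -/
def contourIntegrand (R : ℂ → E →L[ℂ] E) (j n : ℕ) (z : ℂ) (s : ℝ) : E →L[ℂ] E :=
  (Complex.exp (line s) * line s ^ j) • scaledResolvent R z (line s) ^ n

namespace IsSectorialResolvent

variable {z w : ℂ}

/-- The scaled resolvent is at most C/|m| uniformly in z. An exponent exceeding j by at least 2 thus
leaves an integrable majorant independent of z. -/
theorem norm_contourIntegrand_le (hR : IsSectorialResolvent ε C R)
    (hz : z ∈ sector (Real.arctan ε)) (j k : ℕ) (s : ℝ) :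
    ‖contourIntegrand R j (j + 2 + k) z s‖ ≤ Real.exp 1 * C ^ (j + 2 + k) * (1 + s ^ 2)⁻¹ := by
  have hC := hR.const_nonneg
  have hs0 : 0 < ‖line s‖ := norm_pos_iff.2 (line_ne_zero s)
  have hs1 : ‖line s‖⁻¹ ≤ 1 := inv_le_one_of_one_le₀ (one_le_norm_line s)
  rw [contourIntegrand, norm_smul, norm_mul, norm_exp_line, norm_pow, ← normSq_line]
  calc Real.exp 1 * ‖line s‖ ^ j * ‖scaledResolvent R z (line s) ^ (j + 2 + k)‖
      ≤ Real.exp 1 * ‖line s‖ ^ j * (C * ‖line s‖⁻¹) ^ (j + 2 + k) := by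
        gcongr
        refine (norm_pow_le' _ (by omega)).trans ?_
        gcongr
        exact hR.norm_scaledResolvent_le hz s
    _ = Real.exp 1 * C ^ (j + 2 + k) * ((‖line s‖ ^ 2)⁻¹ * ‖line s‖⁻¹ ^ k) := by
        rw [mul_pow, pow_add ‖line s‖⁻¹, pow_add ‖line s‖⁻¹, inv_pow, inv_pow _ 2]
        field_simp
    _ ≤ Real.exp 1 * C ^ (j + 2 + k) * ((‖line s‖ ^ 2)⁻¹ * 1) := by
        gcongr
        exact pow_le_one₀ (by positivity) hs1
    _ = _ := by rw [mul_one]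

theorem continuous_contourIntegrand (hR : IsSectorialResolvent ε C R)
    (hz : z ∈ sector (Real.arctan ε)) (j n : ℕ) : Continuous (contourIntegrand R j n z) :=
  ((Complex.continuous_exp.comp continuous_line).mul (continuous_line.pow j)).smul
    ((hR.continuous_scaledResolvent hz).pow n)

theorem integrable_contourIntegrand (hR : IsSectorialResolvent ε C R)
    (hz : z ∈ sector (Real.arctan ε)) (j k : ℕ) :
    Integrable (contourIntegrand R j (j + 2 + k) z) :=
  (integrable_inv_one_add_sq.const_mul _).mono'
    (hR.continuous_contourIntegrand hz j _).aestronglyMeasurable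
    (Eventually.of_forall fun s => hR.norm_contourIntegrand_le hz j k s)

theorem hasDerivAt_contourIntegrand (hR : IsSectorialResolvent ε C R)
    (hz : z ∈ sector (Real.arctan ε)) (s : ℝ) :
    HasDerivAt (fun z => contourIntegrand R 0 3 z s)
      ((3 * z⁻¹) • (contourIntegrand R 1 4 z s - contourIntegrand R 0 3 z s)) z := by
  have h1 := hR.hasDerivAt_scaledResolvent_left hz.1 (line_div_mem hR.eps_pos hR.eps_le hz s)
  have h3 := ((h1.mul h1).mul h1).const_smul (Complex.exp (line s) * line s ^ 0)
  have hfun : (fun z => contourIntegrand R 0 3 z s) = fun z => (Complex.exp (line s) * line s ^ 0) •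
      (scaledResolvent R z (line s) * scaledResolvent R z (line s) *
        scaledResolvent R z (line s)) := by
    ext1 z
    rw [contourIntegrand, pow_succ, pow_two]
  rw [hfun]
  refine h3.congr_deriv ?_
  simp only [contourIntegrand, Pi.mul_apply]
  generalize scaledResolvent R z (line s) = Q
  simp only [smul_sub, smul_mul_assoc, mul_smul_comm, mul_sub, sub_mul, add_mul, pow_succ,
    pow_zero, one_mul, mul_one, mul_assoc]
  module

/-- Integration by parts: the difference of the two sides is, up to a factor, the integral of the
derivative of e^m (mQ³ - Q²), which vanishes at both ends of the line. Lowering the powers of Q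
gives the form e^m Q² (mQ - 1) = e^m Q² zBQ, in which S' = SB can be recognized. -/
theorem integral_deriv_contourIntegrand [CompleteSpace E] (hR : IsSectorialResolvent ε C R)
    (hz : z ∈ sector (Real.arctan ε)) :
    (3 : ℂ) • ((∫ s, contourIntegrand R 1 4 z s) - ∫ s, contourIntegrand R 0 3 z s)
      = (∫ s, contourIntegrand R 1 3 z s) - ∫ s, contourIntegrand R 0 2 z s := by
  have i14 := hR.integrable_contourIntegrand hz 1 1
  have i03 := hR.integrable_contourIntegrand hz 0 1
  have i13 := hR.integrable_contourIntegrand hz 1 0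
  have i02 := hR.integrable_contourIntegrand hz 0 0
  have hd : ∀ s, HasDerivAt (fun s => contourIntegrand R 1 3 z s - contourIntegrand R 0 2 z s)
      (Complex.I • ((contourIntegrand R 1 3 z s - contourIntegrand R 0 2 z s) -
        (3 : ℂ) • (contourIntegrand R 1 4 z s - contourIntegrand R 0 3 z s))) s := by
    intro s
    have h1 : HasDerivAt (fun s => scaledResolvent R z (line s))
        (Complex.I • (-scaledResolvent R z (line s) ^ 2)) s :=
      (hR.hasDerivAt_scaledResolvent_right (line_div_mem hR.eps_pos hR.eps_le hz s)).scomp s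
        (hasDerivAt_line s)
    have he : HasDerivAt (fun s => Complex.exp (line s)) (Complex.exp (line s) * Complex.I) s :=
      (hasDerivAt_line s).cexp
    have hem := he.mul (hasDerivAt_line s)
    have h := (hem.smul ((h1.mul h1).mul h1)).sub (he.smul (h1.mul h1))
    have hfun : (fun s => contourIntegrand R 1 3 z s - contourIntegrand R 0 2 z s) =
        fun s => (Complex.exp (line s) * line s) • (scaledResolvent R z (line s) *
          scaledResolvent R z (line s) * scaledResolvent R z (line s)) -
          Complex.exp (line s) • (scaledResolvent R z (line s) * scaledResolvent R z (line s)) := by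
      ext1 s
      simp only [contourIntegrand, pow_succ, pow_zero, one_mul, mul_one]
    rw [hfun]
    refine h.congr_deriv ?_
    simp only [contourIntegrand, Pi.mul_apply]
    generalize scaledResolvent R z (line s) = Q
    simp only [smul_sub, smul_add, smul_mul_assoc, mul_smul_comm,
      add_mul, pow_succ, pow_zero, one_mul, mul_one, mul_assoc, neg_mul, mul_neg, smul_neg]
    module
  have hint := (((i13.sub i02).sub ((i14.sub i03).smul (3 : ℂ))).smul Complex.I)
  have hb : ∀ s, ‖contourIntegrand R 1 3 z s - contourIntegrand R 0 2 z s‖ ≤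
      (Real.exp 1 * C ^ 3 + Real.exp 1 * C ^ 2) * (1 + s ^ 2)⁻¹ := by
    intro s
    rw [add_mul]
    exact (norm_sub_le _ _).trans (add_le_add (hR.norm_contourIntegrand_le hz 1 0 s)
      (hR.norm_contourIntegrand_le hz 0 0 s))
  have hlim : Tendsto (fun s : ℝ => (1 + s ^ 2)⁻¹) (cocompact ℝ) (𝓝 0) := by
    refine tendsto_inv_atTop_zero.comp (tendsto_atTop_add_const_left _ _ ?_)
    have := (tendsto_pow_atTop (two_ne_zero)).comp (tendsto_norm_cocompact_atTop (E := ℝ))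
    simpa [Function.comp_def] using this
  have hl0 : Tendsto (fun s => contourIntegrand R 1 3 z s - contourIntegrand R 0 2 z s)
      (cocompact ℝ) (𝓝 0) := by
    refine squeeze_zero_norm hb ?_
    simpa using hlim.const_mul (Real.exp 1 * C ^ 3 + Real.exp 1 * C ^ 2)
  have h := integral_of_hasDerivAt_of_tendsto hd hint (hl0.mono_left atBot_le_cocompact)
    (hl0.mono_left atTop_le_cocompact)
  rw [integral_smul, integral_sub, integral_sub i13 i02, integral_smul, integral_sub i14 i03,
    sub_zero, smul_eq_zero, sub_eq_zero] at h
  · exact (h.resolve_left Complex.I_ne_zero).symm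
  · exact i13.sub i02
  · exact (i14.sub i03).smul (3 : ℂ)

end IsSectorialResolvent

end Resolvents

/-! ### The semigroup: bounds, strong continuity, semigroup law and generator. -/

section Generation

open MeasureTheory

variable {E : Type*} [NormedAddCommGroup E] [NormedSpace ℂ E]

/-- The semigroup generated by the operator with resolvent `R`, by a Dunford integral that is
integrated by parts twice. -/
def contourSemigroup (R : ℂ → E →L[ℂ] E) (z : ℂ) : E →L[ℂ] E :=
  if z = 0 then 1 else (Real.pi : ℂ)⁻¹ • ∫ s, contourIntegrand R 0 3 z s

/-- The derivative of `contourSemigroup`. -/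
def contourSemigroupDeriv (R : ℂ → E →L[ℂ] E) (z : ℂ) : E →L[ℂ] E :=
  ((Real.pi : ℂ)⁻¹ * z⁻¹) •
    ((∫ s, contourIntegrand R 1 3 z s) - ∫ s, contourIntegrand R 0 2 z s)

variable {ε C : ℝ} {R : ℂ → E →L[ℂ] E}

theorem contourSemigroup_zero : contourSemigroup R 0 = 1 := if_pos rfl

theorem contourSemigroup_of_ne_zero {z : ℂ} (hz : z ≠ 0) :
    contourSemigroup R z = (Real.pi : ℂ)⁻¹ • ∫ s, contourIntegrand R 0 3 z s := if_neg hz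

namespace IsSectorialResolvent

variable {z w : ℂ}

theorem exists_norm_contourSemigroup_le (hR : IsSectorialResolvent ε C R) :
    ∃ M : ℝ, 0 ≤ M ∧ ∀ z ∈ sector (Real.arctan ε), ‖contourSemigroup R z‖ ≤ M := by
  have hC := hR.const_nonneg
  refine ⟨‖(Real.pi : ℂ)⁻¹‖ * ∫ s : ℝ, Real.exp 1 * C ^ 3 * (1 + s ^ 2)⁻¹, ?_, fun z hz => ?_⟩
  · exact mul_nonneg (norm_nonneg _) (integral_nonneg fun s => by positivity)
  · rw [contourSemigroup_of_ne_zero hz.1, norm_smul]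
    gcongr
    exact norm_integral_le_of_norm_le (integrable_inv_one_add_sq.const_mul _)
      (Eventually.of_forall fun s => hR.norm_contourIntegrand_le hz 0 1 s)

theorem hasDerivAt_contourSemigroup [CompleteSpace E] (hR : IsSectorialResolvent ε C R)
    (hz : z ∈ sector (Real.arctan ε)) :
    HasDerivAt (contourSemigroup R) (contourSemigroupDeriv R z) z := by
  have hC := hR.const_nonneg
  have hz0 : 0 < ‖z‖ := norm_pos_iff.2 hz.1
  -- Staying away from 0 bounds the factor w⁻¹ in the derivative by 2/‖z‖.
  have hU : sector (Real.arctan ε) ∩ {w | ‖z‖ / 2 < ‖w‖} ∈ 𝓝 z :=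
    ((isOpen_sector_arctan hR.eps_pos).inter (isOpen_lt continuous_const continuous_norm)).mem_nhds
      ⟨hz, by change ‖z‖ / 2 < ‖z‖; linarith⟩
  have h := hasDerivAt_integral_of_dominated_loc_of_deriv_le (μ := volume)
    (F := fun w s => contourIntegrand R 0 3 w s)
    (F' := fun w s => (3 * w⁻¹) • (contourIntegrand R 1 4 w s - contourIntegrand R 0 3 w s))
    (bound := fun s => 3 * (2 / ‖z‖) * ((Real.exp 1 * C ^ 4 + Real.exp 1 * C ^ 3) * (1 + s ^ 2)⁻¹))
    hU ?_ (hR.integrable_contourIntegrand hz 0 1) ?_ ?_ ?_ ?_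
  · have h2 := (h.2.const_smul (Real.pi : ℂ)⁻¹).congr_of_eventuallyEq (f₁ := contourSemigroup R) ?_
    · refine h2.congr_deriv ?_
      rw [integral_smul, integral_sub (hR.integrable_contourIntegrand hz 1 1)
        (hR.integrable_contourIntegrand hz 0 1), mul_comm, mul_smul,
        hR.integral_deriv_contourIntegrand hz, smul_smul]
      rfl
    · filter_upwards [(isOpen_sector_arctan hR.eps_pos).mem_nhds hz] with w hw
      exact contourSemigroup_of_ne_zero hw.1
  · filter_upwards [(isOpen_sector_arctan hR.eps_pos).mem_nhds hz] with w hw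
    exact (hR.continuous_contourIntegrand hw 0 3).aestronglyMeasurable
  · exact (((hR.continuous_contourIntegrand hz 1 4).sub
      (hR.continuous_contourIntegrand hz 0 3)).const_smul (3 * z⁻¹)).aestronglyMeasurable
  · refine Eventually.of_forall fun s w hw => ?_
    have hw0 : ‖z‖ / 2 < ‖w‖ := hw.2
    rw [norm_smul, norm_mul, norm_inv]
    have h3 : ‖(3 : ℂ)‖ = 3 := by simp
    have h4 : ‖w‖⁻¹ ≤ 2 / ‖z‖ := by
      rw [← inv_div]
      exact inv_anti₀ (by positivity) hw0.le
    rw [h3, add_mul]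
    gcongr
    exact (norm_sub_le _ _).trans (add_le_add (hR.norm_contourIntegrand_le hw.1 1 1 s)
      (hR.norm_contourIntegrand_le hw.1 0 1 s))
  · exact (integrable_inv_one_add_sq.const_mul _).const_mul _
  · exact Eventually.of_forall fun s w hw => hR.hasDerivAt_contourIntegrand hw.1 s

/-- This is S'(z) = S(z)B, tested on the range of R(l) so that only bounded operators occur. -/
theorem contourSemigroupDeriv_mul (hR : IsSectorialResolvent ε C R)
    (hz : z ∈ sector (Real.arctan ε)) {l : ℂ} (hl : l ∈ resolventSector ε) :
    contourSemigroupDeriv R z * R l = contourSemigroup R z * (l • R l - 1) := by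
  have i03 := hR.integrable_contourIntegrand hz 0 1
  have i13 := hR.integrable_contourIntegrand hz 1 0
  have i02 := hR.integrable_contourIntegrand hz 0 0
  have hmul : (∫ s, (contourIntegrand R 1 3 z s - contourIntegrand R 0 2 z s) * R l) =
      (∫ s, contourIntegrand R 1 3 z s - contourIntegrand R 0 2 z s) * R l :=
    integral_mul_const_of_integrable (i13.sub i02)
  rw [contourSemigroup_of_ne_zero hz.1, contourSemigroupDeriv, ← integral_sub i13 i02,
    smul_mul_assoc, smul_mul_assoc, ← hmul, ← integral_mul_const_of_integrable i03, mul_smul, ← integral_smul]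
  congr 2
  ext1 s
  have h := hR.scaledResolvent_mul hz s hl
  simp only [contourIntegrand]
  rw [smul_mul_assoc, pow_succ _ 2, mul_assoc, ← h, mul_smul_comm, sub_mul, sub_mul, mul_sub]
  simp only [smul_mul_assoc, mul_smul_comm, pow_succ, pow_zero, one_mul, mul_one, mul_assoc]
  module

theorem contourSemigroup_commute (hR : IsSectorialResolvent ε C R)
    (hz : z ∈ sector (Real.arctan ε)) {l : ℂ} (hl : l ∈ resolventSector ε) :
    Commute (contourSemigroup R z) (R l) := by
  have i03 := hR.integrable_contourIntegrand hz 0 1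
  rw [contourSemigroup_of_ne_zero hz.1]
  refine Commute.smul_left ?_ _
  rw [Commute, SemiconjBy, ← integral_mul_const_of_integrable i03,
    ← integral_const_mul_of_integrable i03]
  congr 1
  ext1 s
  exact (((hR.scaledResolvent_commute hz s hl).pow_left 3).smul_left _).eq

/-- Strong continuity with a rate on the domain of B: write R(l) as the contour integral with m⁻³ in
place of Q³ and compare integrands. -/
theorem exists_norm_contourSemigroup_mul_sub_le [CompleteSpace E] (hR : IsSectorialResolvent ε C R)
    {l : ℂ} (hl : l ∈ resolventSector ε) :
    ∃ K : ℝ, ∀ z ∈ sector (Real.arctan ε), ‖contourSemigroup R z * R l - R l‖ ≤ K * ‖z‖ := by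
  have hC := hR.const_nonneg
  set K : ℝ := Real.exp 1 * ((C ^ 2 + C + 1) * (C * ‖l • R l - 1‖)) with hK
  refine ⟨‖(Real.pi : ℂ)⁻¹‖ * ∫ s : ℝ, K * (1 + s ^ 2)⁻¹, fun z hz => ?_⟩
  have hpi : (Real.pi : ℂ) ≠ 0 := by exact_mod_cast Real.pi_ne_zero
  have i03 := hR.integrable_contourIntegrand hz 0 1
  -- A non-integrable function has integral 0 by convention, whereas this integral is π.
  have iexp : Integrable fun s => Complex.exp (line s) * (line s)⁻¹ ^ 3 := by
    by_contra hcon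
    exact hpi (by rw [← integral_exp_line_div_cube, integral_undef hcon])
  have hRl : R l = (Real.pi : ℂ)⁻¹ • ∫ s, (Complex.exp (line s) * (line s)⁻¹ ^ 3) • R l := by
    rw [integral_smul_const, integral_exp_line_div_cube, smul_smul, inv_mul_cancel₀ hpi, one_smul]
  have hdiff : contourSemigroup R z * R l - R l = (Real.pi : ℂ)⁻¹ • ∫ s,
      (contourIntegrand R 0 3 z s * R l - (Complex.exp (line s) * (line s)⁻¹ ^ 3) • R l) := by
    conv_lhs => rw [hRl]
    rw [integral_sub (i03.mul_const _) (iexp.smul_const _), smul_sub,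
      integral_mul_const_of_integrable i03, contourSemigroup_of_ne_zero hz.1, smul_mul_assoc,
      ← hRl]
  rw [hdiff, norm_smul, mul_assoc, ← integral_mul_const]
  gcongr
  refine norm_integral_le_of_norm_le ((integrable_inv_one_add_sq.const_mul _).mul_const _)
    (Eventually.of_forall fun s => ?_)
  have hs0 : 0 < ‖line s‖ := norm_pos_iff.2 (line_ne_zero s)
  have hs1 : ‖line s‖⁻¹ ≤ 1 := inv_le_one_of_one_le₀ (one_le_norm_line s)
  have hQ := hR.norm_scaledResolvent_le hz s
  have h := hR.scaledResolvent_mul hz s hl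
  have hm := line_ne_zero s
  -- Factor Q³ - m⁻³ = (Q² + m⁻¹Q + m⁻²)(Q - m⁻¹) and use Q - m⁻¹ = m⁻¹zBQ, which supplies the
  -- factor z.
  have heq : contourIntegrand R 0 3 z s * R l - (Complex.exp (line s) * (line s)⁻¹ ^ 3) • R l
      = Complex.exp (line s) • ((scaledResolvent R z (line s) ^ 2 +
        (line s)⁻¹ • scaledResolvent R z (line s) + ((line s)⁻¹ ^ 2) • 1) *
        (((line s)⁻¹ * z) • (scaledResolvent R z (line s) * (l • R l - 1)))) := by
    rw [← h, contourIntegrand, smul_smul, mul_assoc, mul_inv_cancel₀ hz.1]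
    generalize scaledResolvent R z (line s) = Q
    simp only [smul_sub, smul_mul_assoc, mul_smul_comm, mul_sub, sub_mul, add_mul, pow_succ,
      pow_zero, one_mul, mul_one, mul_assoc, smul_add, smul_smul]
    match_scalars <;> field_simp <;> ring
  rw [heq, norm_smul, norm_exp_line]
  have h1 : ‖scaledResolvent R z (line s) ^ 2 +
      (line s)⁻¹ • scaledResolvent R z (line s) + ((line s)⁻¹ ^ 2) • (1 : E →L[ℂ] E)‖
      ≤ C ^ 2 + C + 1 := by
    have hQ1 : ‖scaledResolvent R z (line s)‖ ≤ C := hQ.trans (mul_le_of_le_one_right hC hs1)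
    refine (norm_add_le _ _).trans (add_le_add ((norm_add_le _ _).trans (add_le_add ?_ ?_)) ?_)
    · exact (norm_pow_le' _ two_pos).trans (by gcongr)
    · rw [norm_smul, norm_inv]
      exact (mul_le_mul hs1 hQ1 (norm_nonneg _) zero_le_one).trans (one_mul C).le
    · rw [norm_smul, norm_pow, norm_inv]
      exact mul_le_one₀ (pow_le_one₀ (by positivity) hs1) (norm_nonneg _)
        (ContinuousLinearMap.norm_id_le)
  have h2 : ‖((line s)⁻¹ * z) • (scaledResolvent R z (line s) * (l • R l - 1))‖
      ≤ (‖line s‖⁻¹ * ‖z‖) * ((C * ‖line s‖⁻¹) * ‖l • R l - 1‖) := by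
    rw [norm_smul, norm_mul, norm_inv]
    gcongr
    exact (norm_mul_le _ _).trans (by gcongr)
  calc _ ≤ Real.exp 1 * ((C ^ 2 + C + 1) *
        ((‖line s‖⁻¹ * ‖z‖) * ((C * ‖line s‖⁻¹) * ‖l • R l - 1‖))) := by
        gcongr
        exact (norm_mul_le _ _).trans (by gcongr)
    _ = K * (1 + s ^ 2)⁻¹ * ‖z‖ := by
        rw [← normSq_line, hK]
        field_simp

/-- Convergence holds on the dense range of R(l) and extends to all x by the uniform bound on S. -/
theorem tendsto_contourSemigroup [CompleteSpace E] (hR : IsSectorialResolvent ε C R)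
    {l : ℂ} (hl : l ∈ resolventSector ε) (hd : DenseRange (R l)) (x : E) :
    Tendsto (fun z => contourSemigroup R z x) (𝓝[sector (Real.arctan ε)] 0) (𝓝 x) := by
  obtain ⟨M, hM0, hM⟩ := hR.exists_norm_contourSemigroup_le
  obtain ⟨K, hK⟩ := hR.exists_norm_contourSemigroup_mul_sub_le hl
  rw [Metric.tendsto_nhds]
  intro δ hδ
  obtain ⟨v, hv⟩ := hd.exists_dist_lt x (show 0 < δ / 2 / (M + 1) by positivity)
  have hlim : Tendsto (fun z : ℂ => K * ‖z‖ * ‖v‖) (𝓝[sector (Real.arctan ε)] 0) (𝓝 0) := by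
    have : Tendsto (fun z : ℂ => K * ‖z‖ * ‖v‖) (𝓝 0) (𝓝 (K * ‖(0 : ℂ)‖ * ‖v‖)) :=
      Continuous.tendsto (by fun_prop) 0
    rw [norm_zero, mul_zero, zero_mul] at this
    exact this.mono_left nhdsWithin_le_nhds
  filter_upwards [hlim.eventually (gt_mem_nhds (half_pos hδ)), self_mem_nhdsWithin] with z hz1 hz
  have h1 : ‖contourSemigroup R z (R l v) - R l v‖ ≤ K * ‖z‖ * ‖v‖ :=
    ((contourSemigroup R z * R l - R l).le_opNorm v).trans
      (mul_le_mul_of_nonneg_right (hK z hz) (norm_nonneg _))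
  have h2 : ‖contourSemigroup R z (x - R l v)‖ ≤ M * ‖x - R l v‖ :=
    ((contourSemigroup R z).le_opNorm _).trans
      (mul_le_mul_of_nonneg_right (hM z hz) (norm_nonneg _))
  have h3 : contourSemigroup R z x - x = contourSemigroup R z (x - R l v) +
      (contourSemigroup R z (R l v) - R l v) - (x - R l v) := by
    rw [map_sub]
    abel
  rw [dist_eq_norm] at hv
  rw [lt_div_iff₀ (by positivity)] at hv
  rw [dist_eq_norm, h3]
  have := (norm_sub_le (contourSemigroup R z (x - R l v) +
    (contourSemigroup R z (R l v) - R l v)) (x - R l v)).trans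
      (add_le_add_left (norm_add_le _ _) _)
  linarith

/-- Along r ↦ S((1-r)z) S(w+rz) R(l) the two derivative terms cancel because S' = SB and everything
commutes. The ends r = 0 and r → 1 give S(z)S(w) and S(w+z) on the range of R(l), which is dense. -/
theorem contourSemigroup_add [CompleteSpace E] (hR : IsSectorialResolvent ε C R)
    {l : ℂ} (hl : l ∈ resolventSector ε) (hd : DenseRange (R l))
    (hz : z ∈ sector (Real.arctan ε)) (hw : w ∈ sector (Real.arctan ε)) :
    contourSemigroup R (z + w) = contourSemigroup R z * contourSemigroup R w := by
  have hε := hR.eps_pos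
  obtain ⟨M, hM0, hM⟩ := hR.exists_norm_contourSemigroup_le
  have hm1 : ∀ r : ℝ, r < 1 → ((1 - r : ℝ) : ℂ) * z ∈ sector (Real.arctan ε) := fun r hr =>
    ofReal_mul_mem_sector_arctan hε (sub_pos.2 hr) hz
  have hm2 : ∀ r : ℝ, 0 ≤ r → w + (r : ℂ) * z ∈ sector (Real.arctan ε) := by
    intro r hr
    rcases hr.eq_or_lt with rfl | hr
    · simpa using hw
    · exact add_mem_sector_arctan hε hw (ofReal_mul_mem_sector_arctan hε hr hz)
  set f : ℝ → E →L[ℂ] E := fun r =>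
    contourSemigroup R (((1 - r : ℝ) : ℂ) * z) * contourSemigroup R (w + (r : ℂ) * z) * R l with hf
  have hderiv2 : ∀ r : ℝ, 0 ≤ r → HasDerivAt (fun r : ℝ => contourSemigroup R (w + (r : ℂ) * z))
      (z • contourSemigroupDeriv R (w + (r : ℂ) * z)) r := by
    intro r hr
    have h2 : HasDerivAt (fun r : ℝ => w + (r : ℂ) * z) z r := by
      have := (((hasDerivAt_id r).ofReal_comp).mul_const z).const_add w
      rw [Complex.ofReal_one, one_mul] at this
      exact this
    exact (hR.hasDerivAt_contourSemigroup (hm2 r hr)).scomp r h2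
  have hderiv : ∀ r ∈ Ico (0 : ℝ) 1, HasDerivAt f 0 r := by
    rintro r ⟨hr0, hr1⟩
    have h1 : HasDerivAt (fun r : ℝ => ((1 - r : ℝ) : ℂ) * z) (-z) r := by
      have := (((hasDerivAt_id r).const_sub 1).ofReal_comp).mul_const z
      rw [Complex.ofReal_neg, Complex.ofReal_one, neg_one_mul] at this
      exact this
    have h3 := ((((hR.hasDerivAt_contourSemigroup (hm1 r hr1)).scomp r h1).mul
      (hderiv2 r hr0)).mul_const (R l))
    refine h3.congr_deriv ?_
    rw [Function.comp_apply, add_mul, smul_mul_assoc, mul_smul_comm, smul_mul_assoc, smul_mul_assoc,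
      mul_assoc (contourSemigroupDeriv R _), (hR.contourSemigroup_commute (hm2 r hr0) hl).eq,
      ← mul_assoc (contourSemigroupDeriv R _), hR.contourSemigroupDeriv_mul (hm1 r hr1) hl,
      mul_assoc (contourSemigroup R _) (contourSemigroupDeriv R _),
      hR.contourSemigroupDeriv_mul (hm2 r hr0) hl, mul_assoc (contourSemigroup R _) (l • R l - 1)]
    have hc : (l • R l - 1) * contourSemigroup R (w + (r : ℂ) * z)
        = contourSemigroup R (w + (r : ℂ) * z) * (l • R l - 1) := by
      have := (hR.contourSemigroup_commute (hm2 r hr0) hl).eq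
      rw [sub_mul, mul_sub, smul_mul_assoc, mul_smul_comm, this, one_mul, mul_one]
    rw [hc, neg_smul, neg_add_cancel]
  -- The endpoint r = 1 is excluded, since S is only strongly continuous at the vertex 0; it is
  -- reached below by a limit.
  have hconst : ∀ r ∈ Ico (0 : ℝ) 1, f r = f 0 := by
    rintro r ⟨hr0, hr1⟩
    refine constant_of_has_deriv_right_zero (f := f) (a := 0) (b := r) ?_ ?_ r ⟨hr0, le_rfl⟩
    · exact fun q hq => (hderiv q ⟨hq.1, hq.2.trans_lt hr1⟩).continuousAt.continuousWithinAt
    · exact fun q hq => (hderiv q ⟨hq.1, hq.2.trans hr1⟩).hasDerivWithinAt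
  have hRl : ∀ v, contourSemigroup R (z + w) (R l v)
      = (contourSemigroup R z * contourSemigroup R w) (R l v) := by
    intro v
    have hlim1 : Tendsto (fun r : ℝ => ((1 - r : ℝ) : ℂ) * z) (𝓝[<] 1)
        (𝓝[sector (Real.arctan ε)] 0) := by
      refine tendsto_nhdsWithin_iff.2 ⟨?_, ?_⟩
      · have : Tendsto (fun r : ℝ => ((1 - r : ℝ) : ℂ) * z) (𝓝 1) (𝓝 (((1 - 1 : ℝ) : ℂ) * z)) :=
          Continuous.tendsto (by fun_prop) 1
        rw [sub_self, Complex.ofReal_zero, zero_mul] at this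
        exact this.mono_left nhdsWithin_le_nhds
      · filter_upwards [self_mem_nhdsWithin] with r hr
        exact hm1 r hr
    set g : ℝ → E := fun r => contourSemigroup R (w + (r : ℂ) * z) (R l v) with hg
    have hg1 : Tendsto g (𝓝[<] 1) (𝓝 (g 1)) :=
      (((hderiv2 1 zero_le_one).continuousAt.clm_apply continuousAt_const).tendsto).mono_left
        nhdsWithin_le_nhds
    have hA := (hR.tendsto_contourSemigroup hl hd (g 1)).comp hlim1
    have hB : Tendsto (fun r : ℝ => contourSemigroup R (((1 - r : ℝ) : ℂ) * z) (g r - g 1))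
        (𝓝[<] 1) (𝓝 0) := by
      have h0 : Tendsto (fun r => M * ‖g r - g 1‖) (𝓝[<] 1) (𝓝 0) := by
        simpa using (tendsto_iff_norm_sub_tendsto_zero.1 hg1).const_mul M
      refine squeeze_zero_norm' ?_ h0
      filter_upwards [self_mem_nhdsWithin] with r hr
      exact ((contourSemigroup R _).le_opNorm _).trans
        (mul_le_mul_of_nonneg_right (hM _ (hm1 r hr)) (norm_nonneg _))
    have hAB := hB.add hA
    rw [zero_add] at hAB
    have hconst' : (fun r : ℝ => contourSemigroup R (((1 - r : ℝ) : ℂ) * z) (g r - g 1) +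
        ((fun u => contourSemigroup R u (g 1)) ∘ fun r : ℝ => ((1 - r : ℝ) : ℂ) * z) r)
        =ᶠ[𝓝[<] 1] fun _ => f 0 v := by
      filter_upwards [Ico_mem_nhdsLT (zero_lt_one' ℝ)] with r hr
      rw [← hconst r hr, Function.comp_apply, map_sub, sub_add_cancel]
      rfl
    have := tendsto_nhds_unique (hAB.congr' hconst') tendsto_const_nhds
    simp only [hg, hf, Complex.ofReal_one, one_mul, sub_zero, Complex.ofReal_zero, zero_mul,
      add_zero] at this
    rw [add_comm z w, this]
    rfl
  refine ContinuousLinearMap.coeFn_injective ?_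
  refine DenseRange.equalizer hd (ContinuousLinearMap.continuous _) (ContinuousLinearMap.continuous _) ?_
  ext1 v
  exact hRl v

theorem tendsto_ofReal_sector (hε : 0 < ε) :
    Tendsto (fun t : ℝ => (t : ℂ)) (𝓝[>] 0) (𝓝[sector (Real.arctan ε)] 0) := by
  refine tendsto_nhdsWithin_iff.2 ⟨?_, ?_⟩
  · have : Tendsto (fun t : ℝ => (t : ℂ)) (𝓝 0) (𝓝 ((0 : ℝ) : ℂ)) :=
      Complex.continuous_ofReal.tendsto 0
    rw [Complex.ofReal_zero] at this
    exact this.mono_left nhdsWithin_le_nhds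
  · filter_upwards [self_mem_nhdsWithin] with r hr
    exact ofReal_mem_sector_arctan hε hr

/-- For t > 0 the derivative is S(t)(l R(l)v - v), which converges as t → 0+; a continuous function
whose derivative has a limit at the endpoint is differentiable there. -/
theorem tendsto_slope_contourSemigroup [CompleteSpace E] (hR : IsSectorialResolvent ε C R)
    {l : ℂ} (hl : l ∈ resolventSector ε) (hd : DenseRange (R l)) (v : E) :
    Tendsto (fun t : ℝ => t⁻¹ • (contourSemigroup R (t : ℂ) (R l v) - R l v)) (𝓝[>] 0)
      (𝓝 (l • R l v - v)) := by
  have hε := hR.eps_pos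
  have hlim := hR.tendsto_contourSemigroup hl hd
  set f : ℝ → E := fun t => contourSemigroup R (t : ℂ) (R l v) with hf
  have hf0 : f 0 = R l v := by simp [hf, contourSemigroup_zero]
  have hderiv : ∀ t ∈ Ioi (0 : ℝ),
      HasDerivAt f (contourSemigroup R (t : ℂ) (l • R l v - v)) t := by
    intro t ht
    have hm := ofReal_mem_sector_arctan hε ht
    have h1 := (hR.hasDerivAt_contourSemigroup hm).scomp t ((hasDerivAt_id t).ofReal_comp)
    rw [Complex.ofReal_one, one_smul] at h1
    have h2 := ((ContinuousLinearMap.apply ℂ E (R l v)).restrictScalars ℝ).hasFDerivAt.comp_hasDerivAt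
      t h1
    refine h2.congr_deriv ?_
    exact congrArg (fun L : E →L[ℂ] E => L v) (hR.contourSemigroupDeriv_mul hm hl)
  have h := hasDerivWithinAt_Ici_of_tendsto_deriv (s := Ioi 0) (a := 0) (f := f)
    (e := l • R l v - v) (fun t ht => (hderiv t ht).differentiableAt.differentiableWithinAt)
    (by
      rw [ContinuousWithinAt, hf0]
      exact (hlim (R l v)).comp (tendsto_ofReal_sector hε))
    self_mem_nhdsWithin
    (((hlim (l • R l v - v)).comp (tendsto_ofReal_sector hε)).congr' (by
      filter_upwards [self_mem_nhdsWithin] with t ht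
      exact (hderiv t ht).deriv.symm))
  have h2 := (hasDerivWithinAt_iff_tendsto_slope' (notMem_Ioi.2 le_rfl)).1 h.Ioi_of_Ici
  refine h2.congr fun t => ?_
  rw [slope_def_module, hf0, sub_zero]

theorem tendsto_slope_contourSemigroup_iff [CompleteSpace E] (hR : IsSectorialResolvent ε C R)
    {l : ℂ} (hl : l ∈ resolventSector ε) (hd : DenseRange (R l)) (x y : E) :
    Tendsto (fun t : ℝ => t⁻¹ • (contourSemigroup R (t : ℂ) x - x)) (𝓝[>] 0) (𝓝 y) ↔
      ∃ v, R l v = x ∧ l • R l v - v = y := by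
  constructor
  · intro h
    have h1 := ((R l).continuous.tendsto y).comp h
    -- Commuting R(l) past the difference quotients identifies the limit as B R(l)x. Hence x =
    -- R(l)(lx - y), so the generator does not exceed B.
    have h2 : R l y = l • R l x - x := by
      refine tendsto_nhds_unique h1 ((hR.tendsto_slope_contourSemigroup hl hd x).congr' ?_)
      filter_upwards [self_mem_nhdsWithin] with t ht
      have hc := (hR.contourSemigroup_commute (ofReal_mem_sector_arctan hR.eps_pos ht) hl).eq
      have hc' := congrArg (fun L : E →L[ℂ] E => L x) hc
      simp only [mul_apply_eq_comp] at hc'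
      rw [Function.comp_apply, hc', ← map_sub, ContinuousLinearMap.map_smul_of_tower]
    refine ⟨l • x - y, ?_, ?_⟩
    · rw [map_sub, map_smul, h2]
      abel
    · rw [map_sub, map_smul, h2, sub_sub_cancel, sub_sub_cancel]
  · rintro ⟨v, rfl, rfl⟩
    exact hR.tendsto_slope_contourSemigroup hl hd v

/-- The rescaled semigroup `exp(ω z) S(z)` is analytic and strongly continuous, and its generator
is `B + ω`, where `R` is the resolvent of `B`. -/
theorem exists_isAnalyticSemigroup [CompleteSpace E] (hR : IsSectorialResolvent ε C R)
    {l : ℂ} (hl : l ∈ resolventSector ε) (hd : DenseRange (R l)) (ω : ℂ) :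
    ∃ S : ℂ → E →L[ℂ] E, IsAnalyticSemigroup (Real.arctan ε) S ∧ ∀ x y : E,
      Tendsto (fun t : ℝ => t⁻¹ • (S (t : ℂ) x - x)) (𝓝[>] 0) (𝓝 y) ↔
        ∃ v, R l v = x ∧ (l + ω) • R l v - v = y := by
  refine ⟨fun z => Complex.exp (ω * z) • contourSemigroup R z, ⟨?_, ?_, ?_, ?_⟩, ?_⟩
  · simp [contourSemigroup_zero]
  · intro z hz w hw
    rw [hR.contourSemigroup_add hl hd hz hw, smul_mul_smul_comm, ← Complex.exp_add, mul_add]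
  · intro z hz
    have h1 : DifferentiableAt ℂ (fun z => Complex.exp (ω * z)) z := by fun_prop
    exact (h1.smul (hR.hasDerivAt_contourSemigroup hz).differentiableAt).differentiableWithinAt
  · intro x
    have h1 : Tendsto (fun z => Complex.exp (ω * z)) (𝓝[sector (Real.arctan ε)] 0) (𝓝 1) := by
      have : Tendsto (fun z => Complex.exp (ω * z)) (𝓝 0) (𝓝 (Complex.exp (ω * 0))) :=
        Continuous.tendsto (by fun_prop) 0
      rw [mul_zero, Complex.exp_zero] at this
      exact this.mono_left nhdsWithin_le_nhds
    simpa using h1.smul (hR.tendsto_contourSemigroup hl hd x)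
  · intro x y
    have hexp : ∀ c : ℂ, Tendsto (fun t : ℝ => Complex.exp (c * t)) (𝓝[>] 0) (𝓝 1) := by
      intro c
      have : Tendsto (fun t : ℝ => Complex.exp (c * t)) (𝓝 0) (𝓝 (Complex.exp (c * (0 : ℝ)))) :=
        Continuous.tendsto (by fun_prop) 0
      rw [Complex.ofReal_zero, mul_zero, Complex.exp_zero] at this
      exact this.mono_left nhdsWithin_le_nhds
    have hder : ∀ c : ℂ, Tendsto (fun t : ℝ => t⁻¹ • (Complex.exp (c * t) - 1) • x) (𝓝[>] 0)
        (𝓝 (c • x)) := by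
      intro c
      have h1 : HasDerivAt (fun t : ℝ => Complex.exp (c * t)) c 0 := by
        have h0 : HasDerivAt (fun t : ℝ => c * (t : ℂ)) (c * 1) 0 :=
          ((hasDerivAt_id (0 : ℝ)).ofReal_comp).const_mul c
        simpa using h0.cexp
      have h2 := (hasDerivWithinAt_iff_tendsto_slope' (notMem_Ioi.2 le_rfl)).1
        (h1.hasDerivWithinAt (s := Ioi 0))
      refine (h2.smul_const x).congr fun t => ?_
      rw [slope_def_module, smul_assoc]
      simp
    have hiff : Tendsto (fun t : ℝ => t⁻¹ • ((Complex.exp (ω * t) • contourSemigroup R t) x - x))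
        (𝓝[>] 0) (𝓝 y) ↔
        Tendsto (fun t : ℝ => t⁻¹ • (contourSemigroup R (t : ℂ) x - x)) (𝓝[>] 0)
          (𝓝 (y - ω • x)) := by
      constructor
      · intro h
        have h1 := ((hexp (-ω)).smul h).add (hder (-ω))
        rw [one_smul, neg_smul, ← sub_eq_add_neg] at h1
        refine h1.congr fun t => ?_
        have he : Complex.exp (-ω * t) * Complex.exp (ω * t) = 1 := by
          rw [← Complex.exp_add]; simp
        rw [smul_apply, smul_comm, ← smul_add, smul_sub, smul_smul, he,
          one_smul, sub_smul, one_smul]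
        congr 1
        abel
      · intro h
        have h1 := ((hexp ω).smul h).add (hder ω)
        rw [one_smul, sub_add_cancel] at h1
        refine h1.congr fun t => ?_
        rw [smul_apply, smul_comm, ← smul_add, smul_sub, sub_smul, one_smul]
        congr 1
        abel
    refine hiff.trans ((hR.tendsto_slope_contourSemigroup_iff hl hd x _).trans ?_)
    refine exists_congr fun v => and_congr_right fun hv => ?_
    rw [← hv, eq_sub_iff_add_eq, add_smul]
    constructor
    · intro h
      rw [← h]
      abel
    · intro h
      rw [← h]
      abel

end IsSectorialResolvent

end Generation

/-! ### Weighted spaces -/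

section WeightedSpaces

variable {E : Type*} [NormedAddCommGroup E] [NormedSpace ℝ E] {σ T : ℝ}

theorem memBUC_of_continuous (hσ : σ ≤ 1) {u : ℝ → E} (hu : Continuous u) : MemBUC σ T u := by
  have hpow : Continuous fun t : ℝ => t ^ (1 - σ) := Real.continuous_rpow_const (by linarith)
  have hc : Continuous fun t : ℝ => t ^ (1 - σ) • u t := hpow.smul hu
  refine ⟨hu.continuousOn, ?_, ?_, fun hσ1 => ?_⟩
  · obtain ⟨C, hC⟩ := (isCompact_Icc (a := (0 : ℝ)) (b := T)).exists_bound_of_continuousOn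
      hc.continuousOn
    exact ⟨C, fun t ht => hC t (Ioc_subset_Icc_self ht)⟩
  · exact (isCompact_Icc.uniformContinuousOn_of_continuous hc.continuousOn).mono
      Ioc_subset_Icc_self
  · have h : Tendsto (fun t : ℝ => t ^ (1 - σ) * ‖u t‖) (𝓝 0) (𝓝 ((0 : ℝ) ^ (1 - σ) * ‖u 0‖)) :=
      (hpow.mul hu.norm).tendsto 0
    rw [Real.zero_rpow (by linarith), zero_mul] at h
    exact h.mono_left nhdsWithin_le_nhds

theorem MemBUC.congr (hT : 0 < T) {u v : ℝ → E} (hu : MemBUC σ T u) (h : EqOn u v (Ioc 0 T)) :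
    MemBUC σ T v := by
  refine ⟨hu.continuousOn.congr h.symm, ?_, ?_, fun hσ => ?_⟩
  · obtain ⟨C, hC⟩ := hu.bounded
    exact ⟨C, fun t ht => by rw [← h ht]; exact hC t ht⟩
  · exact hu.uniformContinuousOn.congr fun t ht => by simp only [h ht]
  · refine (hu.tendsto_zero hσ).congr' ?_
    filter_upwards [Ioc_mem_nhdsGT hT] with t ht
    rw [h ht]

theorem timeDeriv_eq {u : ℝ → E} {u' : E} {t : ℝ} (ht : t ∈ Ioc 0 T) (h : HasDerivAt u u' t) :
    timeDeriv T u t = u' :=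
  h.hasDerivWithinAt.derivWithin (uniqueDiffOn_Ioc 0 T t ht)

end WeightedSpaces

theorem normBUC_le {E : Type*} [NormedAddCommGroup E] {σ T : ℝ} {u : ℝ → E} {c : ℝ} (hc : 0 ≤ c)
    (h : ∀ t ∈ Ioc (0 : ℝ) T, t ^ (1 - σ) * ‖u t‖ ≤ c) : normBUC σ T u ≤ c :=
  Real.iSup_le (fun t => h t t.2) hc

/-! ### Solutions with trace zero and the estimates they yield. -/

section TraceZero

variable {E₀ E₁ : Type*} [NormedAddCommGroup E₀] [NormedSpace ℂ E₀]
  [NormedAddCommGroup E₁] [NormedSpace ℂ E₁] {i A : E₁ →L[ℂ] E₀} {σ T : ℝ}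

theorem memE1_of_hasDerivAt (hσ : σ ≤ 1) (hT : 0 < T) {u : ℝ → E₁} {v : ℝ → E₀}
    (hu : Continuous u) (hv : Continuous v) (h : ∀ t, HasDerivAt (fun t => i (u t)) (v t) t) :
    MemE1 i σ T u :=
  ⟨⟨fun t _ => (h t).differentiableAt.differentiableWithinAt,
    memBUC_of_continuous hσ (i.continuous.comp hu),
    (memBUC_of_continuous hσ hv).congr hT fun t ht => (timeDeriv_eq ht (h t)).symm⟩,
    memBUC_of_continuous hσ hu⟩

theorem normE1_nonneg (u : ℝ → E₁) : 0 ≤ normE1 i σ T u :=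
  Real.iSup_nonneg fun t =>
    mul_nonneg (Real.rpow_nonneg t.2.1.le _) (add_nonneg (norm_nonneg _) (norm_nonneg _))

theorem MemE1.le_normE1 {u : ℝ → E₁} (hu : MemE1 i σ T u) {t : ℝ} (ht : t ∈ Ioc (0 : ℝ) T) :
    t ^ (1 - σ) * (‖timeDeriv T (fun s => i (u s)) t‖ + ‖u t‖) ≤ normE1 i σ T u := by
  obtain ⟨C, hC⟩ := hu.mem_buc1.deriv_mem.bounded
  obtain ⟨D, hD⟩ := hu.mem_buc.bounded
  have hbdd : BddAbove (range fun t : Ioc (0 : ℝ) T =>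
      (t : ℝ) ^ (1 - σ) * (‖timeDeriv T (fun s => i (u s)) t‖ + ‖u t‖)) := by
    refine ⟨C + D, ?_⟩
    rintro _ ⟨t, rfl⟩
    have h1 := hC t t.2
    have h2 := hD t t.2
    rw [norm_smul, Real.norm_of_nonneg (Real.rpow_nonneg t.2.1.le _)] at h1 h2
    simp only [mul_add]
    exact add_le_add h1 h2
  exact le_ciSup hbdd ⟨t, ht⟩

theorem memE1_zero (hσ : σ ≤ 1) (hT : 0 < T) : MemE1 i σ T (fun _ => 0) :=
  memE1_of_hasDerivAt (v := fun _ => 0) hσ hT continuous_const continuous_const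
    fun t => hasDerivAt_const t (i 0)

theorem hasTrace_zero : HasTrace i (fun _ => 0) 0 := by
  simp only [HasTrace, map_zero]
  exact tendsto_const_nhds

theorem zero_mem_traceSpace (hσ : σ ≤ 1) (hT : 0 < T) : (0 : E₀) ∈ traceSpace i σ T :=
  ⟨fun _ => 0, memE1_zero hσ hT, hasTrace_zero⟩

theorem normTrace_zero_le (hσ : σ ≤ 1) (hT : 0 < T) : normTrace i σ T 0 ≤ 0 := by
  refine csInf_le ⟨0, ?_⟩ ⟨fun _ => 0, memE1_zero hσ hT, hasTrace_zero, ?_⟩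
  · rintro _ ⟨u, _, _, rfl⟩
    exact normE1_nonneg u
  · refine le_antisymm (Real.iSup_le (fun t => ?_) le_rfl) (normE1_nonneg _)
    simp [timeDeriv]

/-- Solutions with trace zero are bounded by their right-hand sides. -/
theorem MaximalRegularity.exists_bound (hmax : MaximalRegularity i A σ T) (hσ : σ ≤ 1)
    (hT : 0 < T) :
    ∃ M : ℝ, 0 ≤ M ∧ ∀ (f : ℝ → E₀) (u : ℝ → E₁) (c : ℝ), MemBUC σ T f → IsSolution i A σ T f 0 u →
      0 ≤ c → (∀ t ∈ Ioc (0 : ℝ) T, t ^ (1 - σ) * ‖f t‖ ≤ c) → ∀ t ∈ Ioc (0 : ℝ) T,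
        t ^ (1 - σ) * (‖timeDeriv T (fun s => i (u s)) t‖ + ‖u t‖) ≤ M * c := by
  obtain ⟨M, hM⟩ := hmax.bounded_solution
  refine ⟨max M 0, le_max_right _ _, fun f u c hf hu hc hfc t ht => ?_⟩
  have h0 : 0 ≤ normTrace i σ T 0 := by
    refine Real.sInf_nonneg ?_
    rintro _ ⟨u, _, _, rfl⟩
    exact normE1_nonneg u
  have h1 := hM f hf 0 (zero_mem_traceSpace hσ hT) u hu
  rw [le_antisymm (normTrace_zero_le hσ hT) h0, add_zero] at h1
  have h2 : 0 ≤ normBUC σ T f := Real.iSup_nonneg fun t =>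
    mul_nonneg (Real.rpow_nonneg t.2.1.le _) (norm_nonneg _)
  calc _ ≤ normE1 i σ T u := hu.mem.le_normE1 ht
    _ ≤ M * normBUC σ T f := h1
    _ ≤ max M 0 * normBUC σ T f := by gcongr; exact le_max_left _ _
    _ ≤ max M 0 * c := by gcongr; exact normBUC_le hc hfc

/-! ### Resolvent estimates from maximal regularity -/

theorem hasDerivAt_cexp_mul (l : ℂ) (t : ℝ) :
    HasDerivAt (fun t : ℝ => Complex.exp (l * t)) (l * Complex.exp (l * t)) t := by
  have h0 : HasDerivAt (fun t : ℝ => l * (t : ℂ)) (l * 1) t :=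
    ((hasDerivAt_id t).ofReal_comp).const_mul l
  refine h0.cexp.congr_deriv ?_
  ring

theorem norm_cexp_mul_ofReal (l : ℂ) (t : ℝ) :
    ‖Complex.exp (l * t)‖ = Real.exp (l.re * t) := by
  rw [Complex.norm_exp, Complex.re_mul_ofReal]

/-- The factor t in the test function t e^{lt} a forces trace zero. Its price, the extra term e^{lt}
a on the right-hand side, is absorbed for |l| large. -/
theorem MaximalRegularity.exists_norm_le (hmax : MaximalRegularity i A σ T) (hσ : σ ≤ 1)
    (hT : 0 < T) :
    ∃ K ρ : ℝ, 0 ≤ K ∧ ∀ l : ℂ, 0 ≤ l.re → ρ ≤ ‖l‖ → ∀ a : E₁,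
      ‖l‖ * ‖i a‖ + ‖a‖ ≤ K * ‖l • i a - A a‖ := by
  obtain ⟨M, hM0, hM⟩ := hmax.exists_bound hσ hT
  refine ⟨2 * M, 2 * (1 + M) / T, by positivity, fun l hl hρ a => ?_⟩
  set b : E₀ := l • i a - A a with hb
  set u : ℝ → E₁ := fun t => ((t : ℂ) * Complex.exp (l * t)) • a with hu
  set v : ℝ → E₀ := fun t => ((1 + l * t) * Complex.exp (l * t)) • i a with hv
  set f : ℝ → E₀ := fun t => ((t : ℂ) * Complex.exp (l * t)) • b + Complex.exp (l * t) • i a with hf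
  have hder : ∀ t, HasDerivAt (fun t => i (u t)) (v t) t := by
    intro t
    have h0 : HasDerivAt (fun t : ℝ => (t : ℂ)) 1 t := (hasDerivAt_id t).ofReal_comp
    have h1 := (h0.mul (hasDerivAt_cexp_mul l t)).smul_const (i a)
    have h2 : (fun t => i (u t)) = fun t : ℝ => ((t : ℂ) * Complex.exp (l * t)) • i a := by
      ext1 t
      simp only [hu, map_smul]
    rw [h2]
    refine h1.congr_deriv ?_
    simp only [hv]
    congr 1
    ring
  have hfc : Continuous f := by fun_prop
  have huE : MemE1 i σ T u :=
    memE1_of_hasDerivAt hσ hT (by fun_prop) (by fun_prop : Continuous v) hder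
  have hsol : IsSolution i A σ T f 0 u := by
    refine ⟨huE, fun t ht => ?_, ?_⟩
    · rw [timeDeriv_eq ht (hder t)]
      simp only [hv, hu, hf, hb, map_smul]
      module
    · have h1 : Continuous fun t => i (u t) := by fun_prop
      have h2 := h1.tendsto 0
      simp only [hu, Complex.ofReal_zero, zero_mul, zero_smul, map_zero] at h2
      exact h2.mono_left nhdsWithin_le_nhds
  set e : ℝ := T ^ (1 - σ) * Real.exp (l.re * T) with he
  have he0 : 0 < e := mul_pos (Real.rpow_pos_of_pos hT _) (Real.exp_pos _)
  -- Since Re l ≥ 0, both the weight and the exponential are largest at T, so the factor e cancels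
  -- when the solution is evaluated there.
  have hbound : ∀ t ∈ Ioc (0 : ℝ) T, t ^ (1 - σ) * ‖f t‖ ≤ e * (T * ‖b‖ + ‖i a‖) := by
    intro t ht
    have h1 : t ^ (1 - σ) ≤ T ^ (1 - σ) := Real.rpow_le_rpow ht.1.le ht.2 (by linarith)
    have h2 : Real.exp (l.re * t) ≤ Real.exp (l.re * T) :=
      Real.exp_le_exp.2 (mul_le_mul_of_nonneg_left ht.2 hl)
    have h3 : ‖f t‖ ≤ Real.exp (l.re * T) * (T * ‖b‖ + ‖i a‖) := by
      refine (norm_add_le _ _).trans ?_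
      rw [norm_smul, norm_smul, norm_mul, norm_cexp_mul_ofReal, Complex.norm_real,
        Real.norm_of_nonneg ht.1.le, mul_add]
      have h4 : t * Real.exp (l.re * t) ≤ T * Real.exp (l.re * T) :=
        mul_le_mul ht.2 h2 (Real.exp_nonneg _) hT.le
      refine add_le_add ?_ (by gcongr)
      calc _ ≤ T * Real.exp (l.re * T) * ‖b‖ := by gcongr
        _ = _ := by ring
    rw [he, mul_assoc]
    exact mul_le_mul h1 h3 (norm_nonneg _) (Real.rpow_nonneg hT.le _)
  have hmain := hM f u _ (memBUC_of_continuous hσ hfc) hsol (by positivity) hbound T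
    (right_mem_Ioc.2 hT)
  rw [timeDeriv_eq (right_mem_Ioc.2 hT) (hder T)] at hmain
  simp only [hv, hu] at hmain
  rw [norm_smul, norm_smul, norm_mul, norm_mul, norm_cexp_mul_ofReal, Complex.norm_real,
    Real.norm_of_nonneg hT.le] at hmain
  have h5 : e * (‖1 + l * T‖ * ‖i a‖ + T * ‖a‖) ≤ e * (M * (T * ‖b‖ + ‖i a‖)) := by
    rw [he] at hmain ⊢
    linarith
  have h6 := le_of_mul_le_mul_left h5 he0
  have h7 : ‖l‖ * T - 1 ≤ ‖1 + l * T‖ := by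
    have := norm_sub_le (1 + l * (T : ℂ)) 1
    rw [add_sub_cancel_left, norm_mul, Complex.norm_real, Real.norm_of_nonneg hT.le,
      norm_one] at this
    linarith
  rw [div_le_iff₀ hT] at hρ
  -- The condition |l|T ≥ 2(1 + M) lets half of |l|T ‖i a‖ absorb (1 + M)‖i a‖.
  have h8 : T * (‖l‖ * ‖i a‖ + ‖a‖) ≤ T * (2 * M * ‖b‖) := by
    have := mul_le_mul_of_nonneg_right h7 (norm_nonneg (i a))
    have := mul_le_mul_of_nonneg_right hρ (norm_nonneg (i a))
    nlinarith [mul_nonneg hT.le (norm_nonneg a)]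
  exact le_of_mul_le_mul_left h8 hT

/-- The oscillating forcing has constant norm ‖y‖, so ‖u(T)‖ ≤ M‖y‖ independently of l. Integrating
the derivative of e^{-lt} u(t) over (0,T) shows that the truncated Laplace transform misses y only
by terms carrying e^{-Re(l) T}. -/
theorem MaximalRegularity.exists_norm_sub_le [CompleteSpace E₀] [CompleteSpace E₁]
    (hmax : MaximalRegularity i A σ T) (hσ0 : 0 < σ) (hσ : σ ≤ 1) (hT : 0 < T) :
    ∃ ω : ℝ, ∀ l : ℂ, ω ≤ l.re → ∀ y : E₀, ∃ a : E₁, ‖l • i a - A a - y‖ ≤ 1 / 2 * ‖y‖ := by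
  obtain ⟨M, hM0, hM⟩ := hmax.exists_bound hσ hT
  have hlim : Tendsto (fun r : ℝ => Real.exp (-(r * T)) * (1 + r * (‖i‖ * M))) atTop (𝓝 0) := by
    have hrT : Tendsto (fun r : ℝ => r * T) atTop atTop := tendsto_id.atTop_mul_const hT
    have h0 := (Real.tendsto_pow_mul_exp_neg_atTop_nhds_zero 0).comp hrT
    have h1 := ((Real.tendsto_pow_mul_exp_neg_atTop_nhds_zero 1).comp hrT).mul_const
      (‖i‖ * M / T)
    have h2 := h0.add h1
    rw [zero_mul, zero_add] at h2
    refine h2.congr fun r => ?_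
    simp only [Function.comp]
    field_simp
  obtain ⟨ω, hω⟩ := eventually_atTop.1 ((hlim.eventually (gt_mem_nhds (one_half_pos (α := ℝ)))).and
    (eventually_gt_atTop 0))
  refine ⟨ω, fun l hl y => ?_⟩
  obtain ⟨hr, hr0⟩ := hω l.re hl
  set L : E₁ →L[ℂ] E₀ := l • i - A with hL
  set f : ℝ → E₀ := fun t => Complex.exp ((l.im * Complex.I) * t) • y with hf
  have hfm : MemBUC σ T f := memBUC_of_continuous hσ (by fun_prop)
  obtain ⟨u, hu⟩ := hmax.exists_solution f hfm 0 (zero_mem_traceSpace hσ hT)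
  have hfn : ∀ t, ‖f t‖ = ‖y‖ := by
    intro t
    rw [norm_smul, norm_cexp_mul_ofReal]
    simp
  have huT : ‖u T‖ ≤ M * ‖y‖ := by
    have hpos : 0 < T ^ (1 - σ) := Real.rpow_pos_of_pos hT _
    have h := hM f u (T ^ (1 - σ) * ‖y‖) hfm hu (by positivity) (fun t ht => by
      rw [hfn]
      have : t ^ (1 - σ) ≤ T ^ (1 - σ) := Real.rpow_le_rpow ht.1.le ht.2 (by linarith)
      gcongr) T (right_mem_Ioc.2 hT)
    refine le_of_mul_le_mul_left ?_ hpos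
    calc T ^ (1 - σ) * ‖u T‖ ≤ _ := mul_le_mul_of_nonneg_left
          (le_add_of_nonneg_left (norm_nonneg _)) hpos.le
      _ ≤ M * (T ^ (1 - σ) * ‖y‖) := h
      _ = _ := by ring
  have hexpc : Continuous fun t : ℝ => Complex.exp (-l * t) := by fun_prop
  -- In E₁ the solution may blow up like t^{σ-1} at 0, which is integrable because σ > 0.
  have huint : IntervalIntegrable (fun t : ℝ => Complex.exp (-l * t) • u t)
      MeasureTheory.volume 0 T := by
    obtain ⟨C, hC⟩ := hu.mem.mem_buc.bounded
    have hpow : IntervalIntegrable (fun t : ℝ => C * t ^ (σ - 1)) MeasureTheory.volume 0 T :=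
      (intervalIntegral.intervalIntegrable_rpow' (by linarith)).const_mul C
    rw [intervalIntegrable_iff_integrableOn_Ioc_of_le hT.le] at hpow ⊢
    refine hpow.mono' ((hexpc.continuousOn.smul hu.mem.mem_buc.continuousOn).aestronglyMeasurable
      measurableSet_Ioc) (MeasureTheory.ae_restrict_of_forall_mem measurableSet_Ioc fun t ht => ?_)
    have h1 := hC t ht
    rw [norm_smul, Real.norm_of_nonneg (Real.rpow_nonneg ht.1.le _)] at h1
    have h2 : ‖u t‖ ≤ C * t ^ (σ - 1) := by
      have hp : 0 < t ^ (1 - σ) := Real.rpow_pos_of_pos ht.1 _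
      rw [show σ - 1 = -(1 - σ) by ring, Real.rpow_neg ht.1.le, ← div_eq_mul_inv,
        le_div_iff₀ hp, mul_comm]
      exact h1
    rw [norm_smul, norm_cexp_mul_ofReal]
    refine (mul_le_of_le_one_left (norm_nonneg _) (Real.exp_le_one_iff.2 ?_)).trans h2
    rw [Complex.neg_re]
    nlinarith [ht.1]
  have hfe : ∀ t : ℝ, Complex.exp (-l * t) • f t = Complex.exp (-(l.re : ℂ) * t) • y := by
    intro t
    rw [hf, smul_smul, ← Complex.exp_add]
    congr 2
    linear_combination (t : ℂ) * Complex.re_add_im l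
  have hLint : IntervalIntegrable (fun t : ℝ => L (Complex.exp (-l * t) • u t))
      MeasureTheory.volume 0 T := by
    rw [intervalIntegrable_iff_integrableOn_Ioc_of_le hT.le] at huint ⊢
    exact L.integrable_comp huint
  have hyc : Continuous fun t : ℝ => Complex.exp (-(l.re : ℂ) * t) • y := by fun_prop
  have hderiv : ∀ t ∈ Ioo 0 T, HasDerivAt (fun t : ℝ => Complex.exp (-l * t) • i (u t))
      (Complex.exp (-(l.re : ℂ) * t) • y - L (Complex.exp (-l * t) • u t)) t := by
    intro t ht
    have ht' : t ∈ Ioc 0 T := Ioo_subset_Ioc_self ht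
    have h1 : HasDerivAt (fun s => i (u s)) (timeDeriv T (fun s => i (u s)) t) t :=
      ((hu.mem.mem_buc1.differentiableOn t ht').hasDerivWithinAt).hasDerivAt
        (Ioc_mem_nhds ht.1 ht.2)
    refine ((hasDerivAt_cexp_mul (-l) t).smul h1).congr_deriv ?_
    have h2 : timeDeriv T (fun s => i (u s)) t = f t + A (u t) := by
      rw [← hu.eqn t ht', sub_add_cancel]
    rw [h2, ← hfe, hL]
    simp only [map_smul, sub_apply, smul_apply]
    module
  have hzero : Tendsto (fun t : ℝ => Complex.exp (-l * t) • i (u t)) (𝓝[>] 0) (𝓝 0) := by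
    have h := ((hexpc.tendsto 0).mono_left nhdsWithin_le_nhds).smul hu.trace
    rwa [smul_zero] at h
  have hend : Tendsto (fun t : ℝ => Complex.exp (-l * t) • i (u t)) (𝓝[<] T)
      (𝓝 (Complex.exp (-l * T) • i (u T))) := by
    have h := (hexpc.continuousOn.smul hu.mem.mem_buc1.mem.continuousOn) T (right_mem_Ioc.2 hT)
    exact h.tendsto.mono_left (nhdsWithin_le_of_mem
      (mem_of_superset (Ioo_mem_nhdsLT hT) Ioo_subset_Ioc_self))
  have hI := intervalIntegral.integral_eq_sub_of_hasDerivAt_of_tendsto hT hderiv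
    ((hyc.intervalIntegrable 0 T).sub hLint) hzero hend
  have hrc : (l.re : ℂ) ≠ 0 := by exact_mod_cast hr0.ne'
  rw [intervalIntegral.integral_sub (hyc.intervalIntegrable 0 T) hLint,
    intervalIntegral.integral_smul_const, integral_exp_mul_complex (neg_ne_zero.2 hrc),
    L.intervalIntegral_comp_comm huint, sub_zero, Complex.ofReal_zero, mul_zero,
    Complex.exp_zero] at hI
  -- The factor Re l normalizes ∫₀ᵀ e^{-Re(l) t} dt to 1 - e^{-Re(l) T}.
  refine ⟨(l.re : ℂ) • ∫ t in (0 : ℝ)..T, Complex.exp (-l * t) • u t, ?_⟩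
  set a := ∫ t in (0 : ℝ)..T, Complex.exp (-l * t) • u t with ha
  have hLa : l • i ((l.re : ℂ) • a) - A ((l.re : ℂ) • a) = (l.re : ℂ) • L a := by
    rw [hL]
    simp only [map_smul, sub_apply, smul_apply]
    module
  have hfin : (l.re : ℂ) • L a - y = -(Complex.exp (-(l.re : ℂ) * T) • y +
      (l.re : ℂ) • Complex.exp (-l * T) • i (u T)) := by
    rw [← hI, smul_sub, smul_smul]
    have : (l.re : ℂ) * ((Complex.exp (-(l.re : ℂ) * T) - 1) / -(l.re : ℂ))
        = 1 - Complex.exp (-(l.re : ℂ) * T) := by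
      field_simp
      ring
    rw [this]
    module
  rw [hLa, hfin, norm_neg]
  refine (norm_add_le _ _).trans ?_
  rw [norm_smul, norm_smul, norm_smul, norm_cexp_mul_ofReal, norm_cexp_mul_ofReal,
    Complex.norm_real, Real.norm_of_nonneg hr0.le, Complex.neg_re, Complex.neg_re,
    Complex.ofReal_re, neg_mul]
  have h1 : ‖i (u T)‖ ≤ ‖i‖ * (M * ‖y‖) := (i.le_opNorm _).trans (by gcongr)
  calc _ ≤ Real.exp (-(l.re * T)) * ‖y‖ +
        l.re * (Real.exp (-(l.re * T)) * (‖i‖ * (M * ‖y‖))) := by gcongr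
    _ = Real.exp (-(l.re * T)) * (1 + l.re * (‖i‖ * M)) * ‖y‖ := by ring
    _ ≤ 1 / 2 * ‖y‖ := by gcongr

end TraceZero

/-! ### From the estimates on a half-plane to a sectorial resolvent. -/

section Resolvent

variable {E₀ E₁ : Type*} [NormedAddCommGroup E₀] [NormedSpace ℂ E₀]
  [NormedAddCommGroup E₁] [NormedSpace ℂ E₁] {i A : E₁ →L[ℂ] E₀}

/-- A bounded operator that is bounded below and has almost dense range is onto. -/
theorem surjective_of_norm_le_of_norm_sub_le [CompleteSpace E₁] (L : E₁ →L[ℂ] E₀) {K : ℝ}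
    (hK0 : 0 ≤ K) (hK : ∀ a, ‖a‖ ≤ K * ‖L a‖)
    (hL : ∀ y, ∃ a, ‖L a - y‖ ≤ 1 / 2 * ‖y‖) : Function.Surjective L := by
  have hclosed : IsClosed (L.range : Set E₀) := by
    have hanti : AntilipschitzWith ⟨K, hK0⟩ L := L.antilipschitz_of_bound hK
    have hrange : (L.range : Set E₀) = range L := by
      ext
      simp
    rw [hrange]
    exact hanti.isClosed_range L.uniformContinuous
  by_contra hs
  simp only [Function.Surjective, not_forall] at hs
  obtain ⟨y, hy⟩ := hs
  -- If the closed range were proper, some x would have distance at least (3/4)‖x‖ from it, against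
  -- the relative error 1/2.
  obtain ⟨x, hx, hx'⟩ := riesz_lemma (𝕜 := ℂ) hclosed ⟨y, fun h => hy h⟩
    (show (3 / 4 : ℝ) < 1 by norm_num)
  obtain ⟨a, ha⟩ := hL x
  have h1 := hx' (L a) ⟨a, rfl⟩
  rw [norm_sub_rev] at ha
  have h2 : ‖x‖ = 0 := le_antisymm (by linarith) (norm_nonneg x)
  exact hx (by rw [norm_eq_zero.1 h2]; exact Submodule.zero_mem _)

/-- The resolvent estimate on a half-plane extends to a larger sector. -/
theorem exists_sector_estimate [CompleteSpace E₁] {K ω : ℝ} (hK : 0 ≤ K) (hω : 0 ≤ ω)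
    (hest : ∀ l : ℂ, ω ≤ l.re → ∀ a, ‖l‖ * ‖i a‖ + ‖a‖ ≤ K * ‖l • i a - A a‖)
    (hsurj : ∀ l : ℂ, ω ≤ l.re → ∀ y, ∃ a, l • i a - A a = y) :
    ∃ ε : ℝ, 0 < ε ∧ ε ≤ 1 ∧ ∀ m ∈ resolventSector ε,
      (∀ a, ‖m‖ * ‖i a‖ + ‖a‖ ≤ 4 * K * ‖(m + ω) • i a - A a‖) ∧
      ∀ y, ∃ a, (m + ω) • i a - A a = y := by
  have hest' : ∀ m : ℂ, 0 ≤ m.re → ∀ a, ‖m‖ * ‖i a‖ + ‖a‖ ≤ K * ‖(m + ω) • i a - A a‖ := by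
    intro m hm a
    have h1 : ‖m‖ ≤ ‖m + ω‖ := by
      rw [← sq_le_sq₀ (norm_nonneg _) (norm_nonneg _), ← Complex.normSq_eq_norm_sq,
        ← Complex.normSq_eq_norm_sq, Complex.normSq_apply, Complex.normSq_apply, Complex.add_re,
        Complex.add_im, Complex.ofReal_re, Complex.ofReal_im]
      nlinarith
    refine le_trans ?_ (hest (m + ω) (by simpa using hm) a)
    gcongr
  refine ⟨min 1 (1 / (2 * (K + 1))), by positivity, min_le_left _ _, fun m hm => ?_⟩
  set ε := min 1 (1 / (2 * (K + 1))) with hε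
  have hε0 : 0 < ε := by positivity
  rcases le_or_gt 0 m.re with hre | hre
  · refine ⟨fun a => (hest' m hre a).trans ?_, hsurj (m + ω) (by simpa using hre)⟩
    gcongr
    linarith
  · have hεK : ε * K ≤ 1 / 2 := by
      have h1 : ε ≤ 1 / (2 * (K + 1)) := min_le_right _ _
      have h2 : ε * K ≤ 1 / (2 * (K + 1)) * K := by gcongr
      refine h2.trans ?_
      rw [div_mul_eq_mul_div, div_le_div_iff₀ (by positivity) (by norm_num)]
      linarith
    -- For Re m < 0, compare with the projection n of m to the imaginary axis: |Re m| ≤ ε|n| is a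
    -- small perturbation, as εK ≤ 1/2.
    set n : ℂ := m.im * Complex.I with hn
    have hnn : ‖n‖ = |m.im| := by simp [hn]
    have hmn : m = n + m.re := by
      rw [hn, add_comm]
      exact (Complex.re_add_im m).symm
    have hm' : 0 < m.re + ε * |m.im| := hm
    have hre' : ‖(m.re : ℂ)‖ ≤ ε * ‖n‖ := by
      rw [Complex.norm_real, Real.norm_eq_abs, abs_of_neg hre, hnn]
      linarith
    have hnre : n.re = 0 := by simp [hn]
    have hdiff : ∀ a, (m + ω) • i a - A a = ((n + ω) • i a - A a) + (m.re : ℂ) • i a := by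
      intro a
      conv_lhs => rw [hmn]
      module
    have hestn : ∀ a, ε * ‖n‖ * ‖i a‖ ≤ 1 / 2 * ‖(n + ω) • i a - A a‖ ∧
        K * (ε * ‖n‖ * ‖i a‖) ≤ 1 / 2 * (‖n‖ * ‖i a‖) := by
      intro a
      have h1 := hest' n hnre.ge a
      constructor
      · calc ε * ‖n‖ * ‖i a‖ = ε * (‖n‖ * ‖i a‖) := by ring
          _ ≤ ε * (K * ‖(n + ω) • i a - A a‖) := by
            refine mul_le_mul_of_nonneg_left (le_trans ?_ h1) hε0.le
            exact le_add_of_nonneg_right (norm_nonneg a)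
          _ = ε * K * ‖(n + ω) • i a - A a‖ := by ring
          _ ≤ _ := by gcongr
      · calc K * (ε * ‖n‖ * ‖i a‖) = ε * K * (‖n‖ * ‖i a‖) := by ring
          _ ≤ _ := by gcongr
    have hbound : ∀ a, ‖m‖ * ‖i a‖ + ‖a‖ ≤ 4 * K * ‖(m + ω) • i a - A a‖ := by
      intro a
      have h1 := hest' n hnre.ge a
      have h2 : ‖(n + ω) • i a - A a‖ ≤ ‖(m + ω) • i a - A a‖ + ε * ‖n‖ * ‖i a‖ := by
        have : (n + ω) • i a - A a = ((m + ω) • i a - A a) - (m.re : ℂ) • i a := by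
          rw [hdiff a, add_sub_cancel_right]
        rw [this]
        refine (norm_sub_le _ _).trans ?_
        rw [norm_smul]
        gcongr
      -- Half of |n| ‖i a‖ absorbs the perturbation, leaving |n| ‖i a‖ / 2 + ‖a‖ ≤ K ‖(m + ω)a -
      -- Aa‖; multiplying by 4 and using |m| ≤ 2|n| gives the constant 4K.
      have h3 := mul_le_mul_of_nonneg_left h2 hK
      have h4 := (hestn a).2
      have h5 : ‖m‖ ≤ 2 * ‖n‖ := by
        conv_lhs => rw [hmn]
        refine (norm_add_le _ _).trans ?_
        have : ε * ‖n‖ ≤ 1 * ‖n‖ := by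
          gcongr
          exact min_le_left _ _
        linarith
      have h6 := mul_le_mul_of_nonneg_right h5 (norm_nonneg (i a))
      linarith [norm_nonneg a]
    refine ⟨hbound, ?_⟩
    refine surjective_of_norm_le_of_norm_sub_le ((m + ω) • i - A) (K := 4 * K) (by positivity)
      (fun a => ?_) fun y => ?_
    · have := hbound a
      have h0 : 0 ≤ ‖m‖ * ‖i a‖ := by positivity
      exact (le_add_of_nonneg_left h0).trans this
    -- The exact solution at n solves the equation at m up to ‖y‖/2.
    · obtain ⟨a, ha⟩ := hsurj (n + ω) (by simp [hnre]) y
      refine ⟨a, ?_⟩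
      have h1 := hdiff a
      have h2 := (hestn a).1
      rw [ha] at h1 h2
      change ‖(m + ω) • i a - A a - y‖ ≤ _
      rw [h1, add_sub_cancel_left, norm_smul]
      exact (by gcongr : _ ≤ ε * ‖n‖ * ‖i a‖).trans h2

/-- A resolvent estimate on a sector yields an analytic semigroup. -/
theorem generatesAnalyticSemigroup_of_estimate [CompleteSpace E₀] [CompleteSpace E₁]
    (hi : DenseRange i) {ε C : ℝ} {ω : ℂ} (hε : 0 < ε) (hε1 : ε ≤ 1)
    (hC : 0 ≤ C)
    (h : ∀ m ∈ resolventSector ε, (∀ a, ‖m‖ * ‖i a‖ + ‖a‖ ≤ C * ‖(m + ω) • i a - A a‖) ∧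
      ∀ y, ∃ a, (m + ω) • i a - A a = y) :
    GeneratesAnalyticSemigroup i A := by
  have hex : ∀ m : ℂ, ∃ r : E₀ →L[ℂ] E₁, m ∈ resolventSector ε →
      (∀ y, (m + ω) • i (r y) - A (r y) = y) ∧ ∀ a, r ((m + ω) • i a - A a) = a := by
    intro m
    by_cases hm : m ∈ resolventSector ε
    · obtain ⟨h1, h2⟩ := h m hm
      have hinj : Function.Injective ((m + ω) • i - A) := by
        refine (injective_iff_map_eq_zero _).2 fun a ha => ?_
        have h3 := h1 a
        have h0 : 0 ≤ ‖m‖ * ‖i a‖ := by positivity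
        have ha' : (m + ω) • i a - A a = 0 := ha
        rw [ha', norm_zero, mul_zero] at h3
        exact norm_eq_zero.1 (le_antisymm (by linarith) (norm_nonneg a))
      let e := ContinuousLinearEquiv.ofBijective ((m + ω) • i - A)
        (LinearMap.ker_eq_bot.2 hinj) (LinearMap.range_eq_top.2 h2)
      exact ⟨e.symm, fun _ => ⟨fun y => e.apply_symm_apply y, fun a => e.symm_apply_apply a⟩⟩
    -- The value off the sector is arbitrary; it only makes `r` a total function.
    · exact ⟨0, fun hm' => absurd hm' hm⟩
  choose r hr using hex
  have hR : IsSectorialResolvent ε C (fun m => i ∘L r m) := by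
    refine ⟨hε, hε1, fun l hl m hm => ?_, fun m hm => ?_⟩
    · ext y
      have h1 := (hr m hm).1 y
      have h2 := (hr l hl).2 (r m y)
      have h3 : y = ((l + ω) • i (r m y) - A (r m y)) + (m - l) • i (r m y) := by
        nth_rewrite 1 [← h1]
        module
      have h4 : r l y = r m y + (m - l) • r l (i (r m y)) := by
        nth_rewrite 1 [h3]
        rw [map_add, h2, map_smul]
      change i (r l y) - i (r m y) = (m - l) • i (r l (i (r m y)))
      rw [h4, map_add, map_smul, add_sub_cancel_left]
    · have hm0 : 0 < ‖m‖ := norm_pos_iff.2 (ne_zero_of_mem_resolventSector hm)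
      have hy : ∀ y, ‖m‖ * ‖i (r m y)‖ ≤ C * ‖y‖ := by
        intro y
        have h1 := (h m hm).1 (r m y)
        rw [(hr m hm).1 y] at h1
        linarith [norm_nonneg (r m y)]
      have hop : ‖i ∘L r m‖ ≤ C / ‖m‖ := by
        refine ContinuousLinearMap.opNorm_le_bound _ (by positivity) fun y => ?_
        rw [div_mul_eq_mul_div, le_div_iff₀ hm0, mul_comm]
        exact hy y
      rwa [le_div_iff₀ hm0, mul_comm] at hop
  have h1 : (1 : ℂ) ∈ resolventSector ε := by simp [resolventSector]
  -- The range of the resolvent at 1 contains the domain E₁, which is dense.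
  have hd : DenseRange (i ∘L r 1) := by
    refine hi.mono ?_
    rintro _ ⟨a, rfl⟩
    exact ⟨(1 + ω) • i a - A a, congrArg i ((hr 1 h1).2 a)⟩
  obtain ⟨S, hS, hgen⟩ := hR.exists_isAnalyticSemigroup h1 hd ω
  refine ⟨Real.arctan ε, ⟨Real.arctan_pos.2 hε, Real.arctan_lt_pi_div_two ε⟩, S, hS, fun x y => ?_⟩
  rw [hgen x y]
  constructor
  · rintro ⟨v, rfl, rfl⟩
    refine ⟨r 1 v, rfl, ?_⟩
    have := (hr 1 h1).1 v
    nth_rewrite 3 [← this]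
    exact (sub_sub_cancel _ _).symm
  · rintro ⟨a, rfl, rfl⟩
    refine ⟨(1 + ω) • i a - A a, congrArg i ((hr 1 h1).2 a), ?_⟩
    have : (i ∘L r 1) ((1 + ω) • i a - A a) = i a := congrArg i ((hr 1 h1).2 a)
    rw [this, sub_sub_cancel]

theorem MaximalRegularity.generatesAnalyticSemigroup [CompleteSpace E₀] [CompleteSpace E₁]
    (hi : DenseRange i) {σ T : ℝ} (hT : 0 < T) (hσ0 : 0 < σ) (hσ : σ ≤ 1)
    (hmax : MaximalRegularity i A σ T) : GeneratesAnalyticSemigroup i A := by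
  obtain ⟨K, ρ, hK, hest⟩ := hmax.exists_norm_le hσ hT
  obtain ⟨ω₀, happrox⟩ := hmax.exists_norm_sub_le hσ0 hσ hT
  -- On Re l ≥ ω both conclusions are available: |l| ≥ Re l ≥ ρ for the a priori bound and Re l ≥ ω₀
  -- for the approximate solutions.
  set ω : ℝ := max ω₀ (max ρ 0) with hω
  have hω0 : 0 ≤ ω := (le_max_right _ _).trans (le_max_right _ _)
  have hest' : ∀ l : ℂ, ω ≤ l.re → ∀ a, ‖l‖ * ‖i a‖ + ‖a‖ ≤ K * ‖l • i a - A a‖ := by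
    intro l hl a
    refine hest l (hω0.trans hl) ?_ a
    calc ρ ≤ ω := (le_max_left _ _).trans (le_max_right _ _)
      _ ≤ l.re := hl
      _ ≤ ‖l‖ := Complex.re_le_norm l
  have hsurj : ∀ l : ℂ, ω ≤ l.re → ∀ y, ∃ a, l • i a - A a = y := by
    intro l hl
    refine surjective_of_norm_le_of_norm_sub_le (l • i - A) hK (fun a => ?_) fun y => ?_
    · have h0 : 0 ≤ ‖l‖ * ‖i a‖ := by positivity
      exact (le_add_of_nonneg_left h0).trans (hest' l hl a)
    · exact happrox l ((le_max_left _ _).trans hl) y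
  obtain ⟨ε, hε, hε1, h⟩ := exists_sector_estimate hK hω0 hest' hsurj
  exact generatesAnalyticSemigroup_of_estimate hi hε hε1 (by positivity) h

end Resolvent

end PrescribedSingularity

end

theorem mainTheorem2 {E₀ E₁ : Type*}
    [NormedAddCommGroup E₀] [NormedSpace ℂ E₀] [CompleteSpace E₀]
    [NormedAddCommGroup E₁] [NormedSpace ℂ E₁] [CompleteSpace E₁]
    (i : E₁ →L[ℂ] E₀) (hi : PrescribedSingularity.DenselyEmbedded i)
    (A : E₁ →L[ℂ] E₀) (hA : PrescribedSingularity.ClosedOn i A)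
    (T : ℝ) (hT : 0 < T) (σ : ℝ) (hσ : σ ∈ Set.Ioc (0 : ℝ) 1)
    (hmax : PrescribedSingularity.MaximalRegularity i A σ T) :
    PrescribedSingularity.GeneratesAnalyticSemigroup i A := by
  exact hmax.generatesAnalyticSemigroup hi.denseRange hT hσ.1 hσ.2
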